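/- **Conventions.** A ranked alphabet is a finite set of letters $c$ with ranks $\mathrm{rk}(c)\in\mathbb N$; $\mathrm{Tree}(\Sigma)$ is the set of trees over $\Sigma$, and $\mathrm{Tree}(\Sigma,X)$ allows additional leaves labelled in $X$. Types are $A,B ::= o \mid A\multimap B\mid {!A}$. A type is *purely affine* if it contains no $!$, and *almost purely affine* if $!$ is only applied to $o$. Terms (up to renaming of bound variables) are $t,u ::= c \mid x\mid \lambda x.\,t\mid t\,u\mid {!t}\mid \mathtt{let}\ {!x}=u\ \mathtt{in}\ t$. They are typed in contexts $\Theta\mid\Phi$ (unrestricted $\mid$ affine variables) by the rules of dual intuitionistic linear logic with weakening: applications and lets split $\Phi$ and share $\Theta$, $\lambda$ binds an affine variable, $\mathtt{let}$ an unrestricted one, the content of a box ${!t}$ uses no affine variable, and each $c\in\Sigma$ is a constant of type $o^{\mathrm{rk}(c)}\multimap o$. A term is *normal* if no subterm has the form $L\langle\lambda x.\,t\rangle\,u$ or $\mathtt{let}\ {!x}=L\langle{!u}\rangle\ \mathtt{in}\ t$, where $L$ is a (possibly empty) succession of $\mathtt{let}$-binders. **Transducer.** Let $\Gamma,\Sigma$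 be ranked alphabets. Fix a $\lambda$-transducer with almost purely affine memory type $A$, given by normal closed terms $u:A\multimap o$ and $t_a:A^{\mathrm{rk}(a)}\multimap A$ $(a\in\Gamma)$ with constants from $\Sigma$. For $\tau=a(\tau_1,\dots,\tau_k)\in\mathrm{Tree}(\Gamma)$ let $\widehat\tau=t_a\,\widehat{\tau_1}\cdots\widehat{\tau_k}$. **Machines.** A tree-generating machine has a set $\mathcal K$ of configurations, an initial configuration, and a partial step function $\mathcal K\rightharpoonup\mathrm{Tree}(\Sigma,\mathcal K)$; a configuration is *reachable* if it is obtained from the initial one by repeatedly passing from a configuration to a configuration leaf of its image. *IAM.* For $v:o$, the configurations of $\mathrm{APAIAM}(v)$ are the tuples $(d,t,C,T)$ with $d\in\{\downarrow,\uparrow\}$, $C$ a one-hole context, $C\langle t\rangle=v$ and $T\in\{\mathsf p,\circ\}^*$; the initial one is $(\downarrow,v,\langle\cdot\rangle,\varepsilon)$. Writing $(C\langle t^{d}\rangle,T)$ for $(d,t,C,T)$, the steps are $$\begin{aligned} (C\langle (t\,u)^\downarrow\rangle,T)&\mapsto(C\langle t^\downarrow u\rangle,\mathsf pT) & (C\langle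 t^\uparrow u\rangle,\mathsf pT)&\mapsto(C\langle(t\,u)^\uparrow\rangle,T)\\ (C\langle t\,u^\uparrow\rangle,T)&\mapsto(C\langle t^\downarrow u\rangle,\circ T) & (C\langle t^\uparrow u\rangle,\circ T)&\mapsto(C\langle t\,u^\downarrow\rangle,T)\\ (C\langle\lambda x.\,t^\uparrow\rangle,T)&\mapsto(C\langle(\lambda x.\,t)^\uparrow\rangle,\mathsf pT) & (C\langle(\lambda x.\,t)^\downarrow\rangle,\mathsf pT)&\mapsto(C\langle\lambda x.\,t^\downarrow\rangle,T)\\ (C\langle\lambda x.\,D\langle x^\downarrow\rangle\rangle,T)&\mapsto(C\langle(\lambda x.\,D\langle x\rangle)^\uparrow\rangle,\circ T) & (C\langle(\lambda x.\,D\langle x\rangle)^\downarrow\rangle,\circ T)&\mapsto(C\langle\lambda x.\,D\langle x^\uparrow\rangle\rangle,T)\\ (C\langle(\mathtt{let}\,{!x}=u\,\mathtt{in}\,t)^\downarrow\rangle,T)&\mapsto(C\langle\mathtt{let}\,{!x}=u\,\mathtt{in}\,t^\downarrow\rangle,T) & (C\langle\mathtt{let}\,{!x}=u\,\mathtt{in}\,t^\uparrow\rangle,T)&\mapsto(C\langle(\mathtt{let}\,{!x}=u\,\mathtt{in}\,t)^\uparrow\rangle,T)\\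 (C\langle({!t})^\downarrow\rangle,T)&\mapsto(C\langle{!(t^\downarrow)}\rangle,T) & (C\langle\mathtt{let}\,{!x}=u\,\mathtt{in}\,D\langle x^\downarrow\rangle\rangle,T)&\mapsto(C\langle\mathtt{let}\,{!x}=u^\downarrow\,\mathtt{in}\,D\langle x\rangle\rangle,T) \end{aligned}$$ and, for a constant $c$ of rank $k$, $(C\langle c^\downarrow\rangle,\mathsf p^{k}T)\mapsto c\big((C\langle c^\uparrow\rangle,\circ T),(C\langle c^\uparrow\rangle,\mathsf p\circ T),\dots,(C\langle c^\uparrow\rangle,\mathsf p^{k-1}\circ T)\big)$. *Tree-walking transducers.* A tree-walking transducer (TWT) from $\mathrm{Tree}(\Gamma)$ to $\mathrm{Tree}(\Sigma)$ has a finite set $Q$ of states, an initial state $q_0$ and, for each $a\in\Gamma$ with $k=\mathrm{rk}(a)$, partial maps $$\begin{aligned}\delta_a&:Q\times\{\downarrow_\bullet,\circlearrowleft,\uparrow^\bullet_1,\dots,\uparrow^\bullet_k\}\rightharpoonup\mathrm{Tree}(\Sigma,Q\times\{\uparrow_\bullet,\circlearrowleft,\downarrow^\bullet_1,\dots,\downarrow^\bullet_k\}),\\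 \delta^{\mathrm{root}}_a&:Q\times\{\circlearrowleft,\uparrow^\bullet_1,\dots,\uparrow^\bullet_k\}\rightharpoonup\mathrm{Tree}(\Sigma,Q\times\{\circlearrowleft,\downarrow^\bullet_1,\dots,\downarrow^\bullet_k\}).\end{aligned}$$ On input $\tau$ its configurations are triples (state, provenance, node of $\tau$), the initial one is $(q_0,\circlearrowleft,\text{root})$, and a step at $(q,p,\nu)$ applies $\delta^{\mathrm{root}}_a(q,p)$ if $\nu$ is the root and $\delta_a(q,p)$ otherwise ($a$ being the label of $\nu$), then replaces $(q',\downarrow^\bullet_i)$ by $(q',\downarrow_\bullet,i\text{-th child of }\nu)$, $(q',\circlearrowleft)$ by $(q',\circlearrowleft,\nu)$, and $(q',\uparrow_\bullet)$ by $(q',\uparrow^\bullet_j,\text{parent of }\nu)$ if $\nu$ is a $j$-th child. The TWT is *reversible* if, for each single map among all the $\delta_a$ and $\delta_a^{\mathrm{root}}$, each (state, move) pair occurs at most once as a leaf in the whole family of trees that are the values of that map. **States and translation.** Let $H$ be a bound on the lengths of the tapes $T$ of all reachable configurations of $\mathrm{APAIAM}(u\,\widehat\tau)$, for all $\tau\in\mathrm{Tree}(\Gamma)$.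 With fresh constants $\lozenge_i$, let $Q_H$ consist of the following, for $d\in\{\downarrow,\uparrow\}$ and $T\in\{\mathsf p,\circ\}^{\le H}$: $\mathsf I$; $\mathsf T(d,t,C,T)$ with $C\langle t\rangle=t_a\,\lozenge_1\cdots\lozenge_{\mathrm{rk}(a)}$ for some $a\in\Gamma$, $C\ne\langle\cdot\rangle$ and $t\neq\lozenge_i$ for all $i$; $\mathsf U(d,t,C,T)$ with $C\langle t\rangle=u$; $\nabla(T)$; and $\Delta(T)$. For a reachable configuration $\kappa=(d,t,C,T)$ of $\mathrm{APAIAM}(u\,\widehat\tau)$ define $\mathsf{sim}(\kappa)$ as follows. - If $C=\langle\cdot\rangle$: $\mathsf{sim}(\kappa)=(\mathsf I,\circlearrowleft,\text{root})$. - If $t$ is located in $u$, i.e. $C=D\,\widehat\tau$ with $D\langle t\rangle=u$: $\mathsf{sim}(\kappa)=(\mathsf U(d,t,D,T),\circlearrowleft,\text{root})$. - If $t$ is located in $\widehat\tau$: let $\nu$ be the node of $\tau$ whose subtree $\tau'=a(\tau_1,\dots,\tau_k)$ gives the smallest $\widehat{\tau'}$ containing this occurrence of $t$, and let $r$, with context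 $D$, be the subterm at the corresponding position in $t_a\,\lozenge_1\cdots\lozenge_k=D\langle r\rangle$. - If $D\neq\langle\cdot\rangle$: $\mathsf{sim}(\kappa)=(\mathsf T(d,r,D,T),\circlearrowleft,\nu)$. - If $D=\langle\cdot\rangle$ and $d=\downarrow$: $\mathsf{sim}(\kappa)=(\nabla(T),p,\nu)$, with $p=\circlearrowleft$ if $\nu$ is the root and $p=\downarrow_\bullet$ otherwise. - If $D=\langle\cdot\rangle$ and $d=\uparrow$: $\mathsf{sim}(\kappa)=(\Delta(T),\uparrow^\bullet_i,\xi)$ if $\nu$ is the $i$-th child of $\xi$, and $\mathsf{sim}(\kappa)=(\Delta(T),\circlearrowleft,\nu)$ if $\nu$ is the root. **Lemma 5.2.** Such a bound $H$ exists. Moreover, for every such $H$ there is a TWT with set of states $Q_H$ (in particular, $Q_H$ is finite) and initial state $\mathsf I$ such that, for every $\tau\in\mathrm{Tree}(\Gamma)$, $\mathsf{sim}$ maps the reachable configurations of $\mathrm{APAIAM}(u\,\widehat\tau)$ to configurations of the TWT on $\tau$, sends the initial configuration to the initial configuration, and satisfies, for every reachable $\kappa$, $$\mathrm{step}_{\mathrm{TWT}}(\mathsf{sim}(\kappa))=\mathrm{Tree}(\Sigma,\mathsf{sim})\big(\mathrm{step}_{\mathrm{IAM}}(\kappa)\big),$$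 where one side is defined if and only if the other is, and $\mathrm{Tree}(\Sigma,\mathsf{sim})$ applies $\mathsf{sim}$ to the configuration leaves. Furthermore, if the memory type $A$ is purely affine, this TWT can moreover be chosen to be reversible. -/

import Mathlib

namespace LamTWT

/-! Ranked alphabets, trees and tree-generating machines -/

/-- A finite set of letters, each with a rank. -/
structure RankedAlphabet where
  Letter : Type
  finite : Finite Letter
  rk : Letter → ℕ

/-- Trees over `S` with additional leaves labelled in `X`. -/
inductive Tree (S : RankedAlphabet) (X : Type) : Type
  | leaf (x : X) : Tree S X
  | node (c : S.Letter) (ts : Fin (S.rk c) → Tree S X) : Tree S X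

/-- Trees over `Γ`, without additional leaves. -/
abbrev GroundTree (Γ : RankedAlphabet) : Type := Tree Γ Empty

namespace Tree
variable {S : RankedAlphabet} {X Y : Type}

/-- Relabel the `X`-leaves. -/
def map (f : X → Y) : Tree S X → Tree S Y
  | leaf x => leaf (f x)
  | node c ts => node c fun i => (ts i).map f

/-- The list of labels of `X`-leaves, with multiplicities. -/
def leaves : Tree S X → List X
  | leaf x => [x]
  | node _ ts => (List.ofFn fun i => (ts i).leaves).flatten

end Tree

/-- A tree-generating machine: configurations, an initial one, and a partial step function. -/
structure Machine (S : RankedAlphabet) where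
  Config : Type
  init : Config
  step : Config → Option (Tree S Config)

namespace Machine
variable {S : RankedAlphabet}

/-- `κ'` is one of the configurations spawned by one computation step from `κ`. -/
def Succ (M : Machine S) (κ κ' : M.Config) : Prop :=
  ∃ t, M.step κ = some t ∧ κ' ∈ t.leaves

/-- The configurations that appear in a run of the machine. -/
def Reachable (M : Machine S) (κ : M.Config) : Prop :=
  Relation.ReflTransGen M.Succ M.init κ

/-- `f` is a step-by-step simulation of `M` by `N`: it sends the initial configuration to the
initial one, and on the configurations that appear in runs of `M` it commutes with the
(partial) computation-step functions. In particular one side is undefined iff the other is. -/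
def IsSimulation (M N : Machine S) (f : M.Config → N.Config) : Prop :=
  f M.init = N.init ∧
    ∀ κ, M.Reachable κ → N.step (f κ) = (M.step κ).map (Tree.map f)

end Machine

/-! Types and terms -/

/-- Types `A, B ::= o | A ⊸ B | !A`. -/
inductive Ty : Type
  | o : Ty
  | arrow (A B : Ty) : Ty
  | bang (A : Ty) : Ty

namespace Ty

/-- No `!` at all. -/
def PurelyAffine : Ty → Prop
  | o => True
  | arrow A B => A.PurelyAffine ∧ B.PurelyAffine
  | bang _ => False

/-- The only occurrences of `!` are applied to `o`. -/
def AlmostPurelyAffine : Ty → Prop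
  | o => True
  | arrow A B => A.AlmostPurelyAffine ∧ B.AlmostPurelyAffine
  | bang A => A = o

/-- `A^k ⊸ B`, that is `A ⊸ ⋯ ⊸ A ⊸ B` with `k` arguments. -/
def arrows (A : Ty) : ℕ → Ty → Ty
  | 0, B => B
  | k + 1, B => arrow A (arrows A k B)

end Ty

/-- Terms up to renaming of bound variables, in de Bruijn notation: `lam t` binds index `0` in
`t`, and `letb u t` is `let !x = u in t`, which binds index `0` in `t` (not in `u`).
Constants are the letters of `S`. The `mark i` are the formal constants `◊ᵢ` (numbered from `0`),
which have no typing rule, hence occur in no well-typed term. -/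
inductive Term (S : RankedAlphabet) : Type
  | const (c : S.Letter) : Term S
  | mark (i : ℕ) : Term S
  | var (n : ℕ) : Term S
  | lam (t : Term S) : Term S
  | app (t u : Term S) : Term S
  | bang (t : Term S) : Term S
  | letb (u t : Term S) : Term S

/-- What a typing context says about one variable: unrestricted of type `A` (it belongs to `Θ`),
affine of type `A` (it belongs to `Φ`), or not available. -/
inductive Hyp : Type
  | unr (A : Ty) : Hyp
  | aff (A : Ty) : Hyp
  | absent : Hyp

/-- Remove an affine hypothesis. -/
def Hyp.dropAffine : Hyp → Hyp
  | unr A => unr A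
  | aff _ => absent
  | absent => absent

/-- `Split Δ Δ₁ Δ₂`: if `Δ` is `Θ | Φ, Φ'` (disjoint union), `Δ₁` is `Θ | Φ` and `Δ₂` is
`Θ | Φ'`. -/
inductive Split : List Hyp → List Hyp → List Hyp → Prop
  | nil : Split [] [] []
  | unr {Δ Δ₁ Δ₂ : List Hyp} (A : Ty) : Split Δ Δ₁ Δ₂ →
      Split (.unr A :: Δ) (.unr A :: Δ₁) (.unr A :: Δ₂)
  | left {Δ Δ₁ Δ₂ : List Hyp} (A : Ty) : Split Δ Δ₁ Δ₂ →
      Split (.aff A :: Δ) (.aff A :: Δ₁) (.absent :: Δ₂)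
  | right {Δ Δ₁ Δ₂ : List Hyp} (A : Ty) : Split Δ Δ₁ Δ₂ →
      Split (.aff A :: Δ) (.absent :: Δ₁) (.aff A :: Δ₂)
  | absent {Δ Δ₁ Δ₂ : List Hyp} : Split Δ Δ₁ Δ₂ →
      Split (.absent :: Δ) (.absent :: Δ₁) (.absent :: Δ₂)

/-- Typing judgements `Θ | Φ ⊢ t : A`. The body of a box uses no affine variable; the box itself
may be put in any affine context (weakening). A letter `c` is a constant of type
`o^(rk c) ⊸ o`. -/
inductive HasType {S : RankedAlphabet} : List Hyp → Term S → Ty → Prop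
  | const (Δ : List Hyp) (c : S.Letter) :
      HasType Δ (.const c) (Ty.arrows .o (S.rk c) .o)
  | affVar {Δ : List Hyp} {n : ℕ} {A : Ty} : Δ[n]? = some (.aff A) → HasType Δ (.var n) A
  | unrVar {Δ : List Hyp} {n : ℕ} {A : Ty} : Δ[n]? = some (.unr A) → HasType Δ (.var n) A
  | lam {Δ : List Hyp} {t : Term S} {A B : Ty} :
      HasType (.aff A :: Δ) t B → HasType Δ (.lam t) (.arrow A B)
  | app {Δ Δ₁ Δ₂ : List Hyp} {t u : Term S} {A B : Ty} : Split Δ Δ₁ Δ₂ →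
      HasType Δ₁ t (.arrow A B) → HasType Δ₂ u A → HasType Δ (.app t u) B
  | bang {Δ : List Hyp} {t : Term S} {A : Ty} :
      HasType (Δ.map Hyp.dropAffine) t A → HasType Δ (.bang t) (.bang A)
  | letb {Δ Δ₁ Δ₂ : List Hyp} {u t : Term S} {A B : Ty} : Split Δ Δ₁ Δ₂ →
      HasType Δ₁ u (.bang A) → HasType (.unr A :: Δ₂) t B → HasType Δ (.letb u t) B

namespace Term
variable {S : RankedAlphabet}

/-- Strip the outermost `let`-binders: `t = L⟨stripLets t⟩` where `L` is a maximal succession of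
`let`-binders. -/
def stripLets : Term S → Term S
  | letb _ t => t.stripLets
  | t => t

/-- `t = L⟨λx. t'⟩` for some succession `L` of `let`-binders. -/
def IsLetsLam (t : Term S) : Prop := ∃ t', t.stripLets = lam t'

/-- `t = L⟨!t'⟩` for some succession `L` of `let`-binders. -/
def IsLetsBang (t : Term S) : Prop := ∃ t', t.stripLets = bang t'

/-- β-normal forms: no subterm is a redex `L⟨λx. t⟩ u` or `let !x = L⟨!u⟩ in t`. -/
def Normal : Term S → Prop
  | const _ => True
  | mark _ => True
  | var _ => True
  | lam t => t.Normal
  | app t u => t.Normal ∧ u.Normal ∧ ¬ t.IsLetsLam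
  | bang t => t.Normal
  | letb u t => u.Normal ∧ t.Normal ∧ ¬ u.IsLetsBang

/-- `t u₁ ⋯ uₖ`. -/
def apps (t : Term S) (us : List (Term S)) : Term S := us.foldl app t

end Term

/-! One-hole contexts -/

/-- One layer of a context: `λx. ·`, `· u`, `t ·`, `!·`, `let !x = · in t`, `let !x = u in ·`. -/
inductive Frame (S : RankedAlphabet) : Type
  | lam : Frame S
  | appL (u : Term S) : Frame S
  | appR (t : Term S) : Frame S
  | bang : Frame S
  | letArg (t : Term S) : Frame S
  | letBody (u : Term S) : Frame S

/-- Fill the hole of a frame. -/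
def Frame.plug {S : RankedAlphabet} : Frame S → Term S → Term S
  | lam, t => .lam t
  | appL u, t => .app t u
  | appR t, u => .app t u
  | bang, t => .bang t
  | letArg t, u => .letb u t
  | letBody u, t => .letb u t

/-- Whether a frame binds a variable in its hole. -/
def Frame.binds {S : RankedAlphabet} : Frame S → Bool
  | lam => true
  | letBody _ => true
  | _ => false

/-- A context, as the list of its layers **from the hole outwards**. The empty list is the hole;
`D ++ C` is `C⟨D⟩`. -/
abbrev Ctx (S : RankedAlphabet) : Type := List (Frame S)

/-- `C⟨t⟩`, with capture. -/
def Ctx.plug {S : RankedAlphabet} : Ctx S → Term S → Term S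
  | [], t => t
  | f :: C, t => Ctx.plug C (f.plug t)

theorem Ctx.plug_append {S : RankedAlphabet} (D C : Ctx S) (t : Term S) :
    Ctx.plug (D ++ C) t = Ctx.plug C (Ctx.plug D t) := by
  induction D generalizing t with
  | nil => rfl
  | cons f D ih => exact ih (f.plug t)

/-- Given a variable of index `n` in the hole of `C`, find its binder:
`C = C'⟨f⟨D⟩⟩` where the frame `f` binds the variable. `none` if the variable is free. -/
def Ctx.binder {S : RankedAlphabet} : ℕ → Ctx S → Option (Ctx S × Frame S × Ctx S)
  | _, [] => none
  | n, f :: C =>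
    match f.binds, n with
    | true, 0 => some ([], f, C)
    | true, n + 1 => (Ctx.binder n C).map fun r => (f :: r.1, r.2)
    | false, n => (Ctx.binder n C).map fun r => (f :: r.1, r.2)

theorem Ctx.binder_eq {S : RankedAlphabet} (C : Ctx S) : ∀ (n : ℕ) (D : Ctx S) (f : Frame S)
    (C' : Ctx S), Ctx.binder n C = some (D, f, C') → C = D ++ f :: C' := by
  induction C with
  | nil => intro n D f C' h; simp [Ctx.binder] at h
  | cons g C ih =>
    intro n D f C' h
    unfold Ctx.binder at h
    split at h
    · simp only [Option.some.injEq, Prod.mk.injEq] at h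
      obtain ⟨rfl, rfl, rfl⟩ := h
      rfl
    · obtain ⟨⟨D', f', C''⟩, h1, h2⟩ := Option.map_eq_some_iff.1 h
      simp only [Prod.mk.injEq] at h2
      obtain ⟨rfl, rfl, rfl⟩ := h2
      exact congrArg (g :: ·) (ih _ _ _ _ h1)
    · obtain ⟨⟨D', f', C''⟩, h1, h2⟩ := Option.map_eq_some_iff.1 h
      simp only [Prod.mk.injEq] at h2
      obtain ⟨rfl, rfl, rfl⟩ := h2
      exact congrArg (g :: ·) (ih _ _ _ _ h1)

/-- The (leftmost) occurrence in `t` of the variable that has index `n` at the root of `t`: the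
context `D` of the occurrence and the index `m` of the variable there, so that `t = D⟨var m⟩`.
In a well-typed term, a `λ`-bound variable has at most one occurrence. -/
def Term.occ {S : RankedAlphabet} : ℕ → Term S → Option (Ctx S × ℕ)
  | _, .const _ => none
  | _, .mark _ => none
  | n, .var m => if m = n then some ([], m) else none
  | n, .lam t => (t.occ (n + 1)).map fun r => (r.1 ++ [.lam], r.2)
  | n, .app t u =>
      ((t.occ n).map fun r => (r.1 ++ [.appL u], r.2)) <|>
        ((u.occ n).map fun r => (r.1 ++ [.appR t], r.2))
  | n, .bang t => (t.occ n).map fun r => (r.1 ++ [.bang], r.2)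
  | n, .letb u t =>
      ((u.occ n).map fun r => (r.1 ++ [.letArg t], r.2)) <|>
        ((t.occ (n + 1)).map fun r => (r.1 ++ [.letBody u], r.2))

theorem Term.plug_occ {S : RankedAlphabet} (t : Term S) : ∀ (n : ℕ) (D : Ctx S) (m : ℕ),
    t.occ n = some (D, m) → Ctx.plug D (.var m) = t := by
  induction t with
  | const c => intro n D m h; simp [Term.occ] at h
  | mark i => intro n D m h; simp [Term.occ] at h
  | var k =>
    intro n D m h
    simp only [Term.occ] at h
    split_ifs at h
    simp only [Option.some.injEq, Prod.mk.injEq] at h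
    obtain ⟨rfl, rfl⟩ := h
    rfl
  | lam t ih =>
    intro n D m h
    simp [Term.occ] at h
    obtain ⟨D', h1, rfl⟩ := h
    simp [Ctx.plug_append, Ctx.plug, Frame.plug, ih _ _ _ h1]
  | bang t ih =>
    intro n D m h
    simp [Term.occ] at h
    obtain ⟨D', h1, rfl⟩ := h
    simp [Ctx.plug_append, Ctx.plug, Frame.plug, ih _ _ _ h1]
  | app t u iht ihu =>
    intro n D m h
    simp [Term.occ] at h
    rcases h with ⟨D', h1, rfl⟩ | ⟨_, D', h1, rfl⟩
    · simp [Ctx.plug_append, Ctx.plug, Frame.plug, iht _ _ _ h1]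
    · simp [Ctx.plug_append, Ctx.plug, Frame.plug, ihu _ _ _ h1]
  | letb u t ihu iht =>
    intro n D m h
    simp [Term.occ] at h
    rcases h with ⟨D', h1, rfl⟩ | ⟨_, D', h1, rfl⟩
    · simp [Ctx.plug_append, Ctx.plug, Frame.plug, ihu _ _ _ h1]
    · simp [Ctx.plug_append, Ctx.plug, Frame.plug, iht _ _ _ h1]

/-! The almost purely affine interaction abstract machine -/

/-- The direction of the token. -/
inductive Polarity : Type
  | down : Polarity
  | up : Polarity

/-- Tape symbols `p` and `∘`. -/
inductive Sym : Type
  | p : Sym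
  | c : Sym
  deriving DecidableEq

abbrev Tape : Type := List Sym

/-- Configurations `(d, t, C, T)` with `C⟨t⟩ = v`. -/
structure IAMConfig {S : RankedAlphabet} (v : Term S) where
  dir : Polarity
  focus : Term S
  ctx : Ctx S
  tape : Tape
  plug_eq : Ctx.plug ctx focus = v

/-- The computation-step function. -/
def iamStep {S : RankedAlphabet} (v : Term S) :
    IAMConfig v → Option (Tree S (IAMConfig v))
  -- applications
  | ⟨.down, .app t u, C, T, h⟩ => some (.leaf ⟨.down, t, .appL u :: C, .p :: T, h⟩)
  | ⟨.up, t, .appL u :: C, .p :: T, h⟩ => some (.leaf ⟨.up, .app t u, C, T, h⟩)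
  | ⟨.up, u, .appR t :: C, T, h⟩ => some (.leaf ⟨.down, t, .appL u :: C, .c :: T, h⟩)
  | ⟨.up, t, .appL u :: C, .c :: T, h⟩ => some (.leaf ⟨.down, u, .appR t :: C, T, h⟩)
  -- abstractions
  | ⟨.up, t, .lam :: C, T, h⟩ => some (.leaf ⟨.up, .lam t, C, .p :: T, h⟩)
  | ⟨.down, .lam t, C, .p :: T, h⟩ => some (.leaf ⟨.down, t, .lam :: C, T, h⟩)
  | ⟨.down, .lam t, C, .c :: T, h⟩ =>
    match hD : t.occ 0 with
    | some (D, m) => some (.leaf ⟨.up, .var m, D ++ .lam :: C, T, by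
        rw [Ctx.plug_append, Term.plug_occ t 0 D m hD]; exact h⟩)
    | none => none
  -- variables, bound by an abstraction or by a `let`
  | ⟨.down, .var n, C, T, h⟩ =>
    match hC : Ctx.binder n C with
    | some (D, .lam, C') => some (.leaf ⟨.up, .lam (Ctx.plug D (.var n)), C', .c :: T, by
        rw [Ctx.binder_eq C n _ _ _ hC, Ctx.plug_append] at h; exact h⟩)
    | some (D, .letBody u, C') =>
      some (.leaf ⟨.down, u, .letArg (Ctx.plug D (.var n)) :: C', T, by
        rw [Ctx.binder_eq C n _ _ _ hC, Ctx.plug_append] at h; exact h⟩)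
    | _ => none
  -- constants
  | ⟨.down, .const c, C, T, h⟩ =>
    if T.take (S.rk c) = List.replicate (S.rk c) Sym.p then
      some (.node c fun i =>
        .leaf ⟨.up, .const c, C, List.replicate i.val Sym.p ++ .c :: T.drop (S.rk c), h⟩)
    else none
  -- `let`-bindings and boxes
  | ⟨.down, .letb u t, C, T, h⟩ => some (.leaf ⟨.down, t, .letBody u :: C, T, h⟩)
  | ⟨.down, .bang t, C, T, h⟩ => some (.leaf ⟨.down, t, .bang :: C, T, h⟩)
  | ⟨.up, t, .letBody u :: C, T, h⟩ => some (.leaf ⟨.up, .letb u t, C, T, h⟩)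
  | _ => none

/-- `APAIAM(v)`. -/
def apaiam {S : RankedAlphabet} (v : Term S) : Machine S where
  Config := IAMConfig v
  init := ⟨.down, v, [], [], rfl⟩
  step := iamStep v

/-! Nodes of trees and tree-walking transducers -/

/-- Nodes of a tree, as paths from the root. -/
inductive Node {Γ : RankedAlphabet} : GroundTree Γ → Type
  | root {τ : GroundTree Γ} : Node τ
  | child {a : Γ.Letter} {ts : Fin (Γ.rk a) → GroundTree Γ} (i : Fin (Γ.rk a))
      (ν : Node (ts i)) : Node (.node a ts)

namespace Node
variable {Γ : RankedAlphabet}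

/-- The label of a node. -/
def label : {τ : GroundTree Γ} → Node τ → Γ.Letter
  | .leaf e, root => e.elim
  | .node a _, root => a
  | _, child _ ν => ν.label

/-- The number of children of a node. -/
abbrev arity {τ : GroundTree Γ} (ν : Node τ) : ℕ := Γ.rk ν.label

/-- The `i`-th child of a node. -/
def childAt : {τ : GroundTree Γ} → (ν : Node τ) → Fin ν.arity → Node τ
  | .leaf e, root, _ => e.elim
  | .node _ _, root, i => child i root
  | _, child j ν, i => child j (ν.childAt i)

/-- `ν.parent = some ⟨ξ, i⟩` if `ν` is the `i`-th child of `ξ`; `none` if `ν` is the root. -/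
def parent : {τ : GroundTree Γ} → Node τ → Option ((ξ : Node τ) × Fin ξ.arity)
  | _, root => none
  | .node _ _, child i ν =>
    match ν.parent with
    | none => some ⟨root, i⟩
    | some ⟨ξ, j⟩ => some ⟨child i ξ, j⟩

end Node

/-- Directions around a node with `k` children. As provenances, `parent`, `stay`, `child i` are
`↓•` (coming from the parent), `↻`, `↑ᵢ•` (coming from the `i`-th child); as moves, they are
`↑•` (to the parent), `↻`, `↓ᵢ•` (to the `i`-th child). -/
inductive Dir (k : ℕ) : Type
  | parent : Dir k
  | stay : Dir k
  | child (i : Fin k) : Dir k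

/-- Directions around the root. -/
inductive RootDir (k : ℕ) : Type
  | stay : RootDir k
  | child (i : Fin k) : RootDir k

/-- A tree-walking transducer `Tree(Γ) ⇀ Tree(S)` with (finite) set of states `Q`. -/
structure TWT (Γ S : RankedAlphabet) (Q : Type) where
  finite : Finite Q
  init : Q
  δ : (a : Γ.Letter) → Q × Dir (Γ.rk a) → Option (Tree S (Q × Dir (Γ.rk a)))
  δroot : (a : Γ.Letter) → Q × RootDir (Γ.rk a) → Option (Tree S (Q × RootDir (Γ.rk a)))

/-- A configuration on the input tree `τ`: a state, a node, and a provenance. -/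
structure TWTConfig {Γ : RankedAlphabet} (Q : Type) (τ : GroundTree Γ) where
  state : Q
  node : Node τ
  prov : Dir node.arity

/-- Apply a function to the state. -/
def TWTConfig.mapState {Γ : RankedAlphabet} {Q Q' : Type} {τ : GroundTree Γ} (f : Q → Q')
    (c : TWTConfig Q τ) : TWTConfig Q' τ :=
  ⟨f c.state, c.node, c.prov⟩

namespace TWT
variable {Γ S : RankedAlphabet} {Q : Type}

/-- The configuration reached by a move from the root. -/
def moveRoot {τ : GroundTree Γ} (ν : Node τ) : Q × RootDir ν.arity → TWTConfig Q τ
  | (q, .stay) => ⟨q, ν, .stay⟩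
  | (q, .child i) => ⟨q, ν.childAt i, .parent⟩

/-- The configuration reached by a move from `ν`, which is the `j`-th child of `ξ`. -/
def move {τ : GroundTree Γ} (ν ξ : Node τ) (j : Fin ξ.arity) :
    Q × Dir ν.arity → TWTConfig Q τ
  | (q, .parent) => ⟨q, ξ, .child j⟩
  | (q, .stay) => ⟨q, ν, .stay⟩
  | (q, .child i) => ⟨q, ν.childAt i, .parent⟩

/-- The computation-step function on the input `τ`. -/
def step (M : TWT Γ S Q) (τ : GroundTree Γ) (c : TWTConfig Q τ) :
    Option (Tree S (TWTConfig Q τ)) :=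
  match c.node.parent with
  | none =>
    match c.prov with
    | .parent => none
    | .stay => (M.δroot c.node.label (c.state, .stay)).map (Tree.map (moveRoot c.node))
    | .child i => (M.δroot c.node.label (c.state, .child i)).map (Tree.map (moveRoot c.node))
  | some ⟨ξ, j⟩ => (M.δ c.node.label (c.state, c.prov)).map (Tree.map (move c.node ξ j))

/-- The tree-generating machine associated to an input tree. -/
def machine (M : TWT Γ S Q) (τ : GroundTree Γ) : Machine S where
  Config := TWTConfig Q τ
  init := ⟨M.init, .root, .stay⟩
  step := M.step τ

/-- In the family of trees `δ x`, for `x` in the domain of the partial function `δ`, each `y`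
occurs at most once as a leaf. -/
def LeafInjective {X Y : Type} (δ : X → Option (Tree S Y)) : Prop :=
  (∀ x t, δ x = some t → t.leaves.Nodup) ∧
    ∀ x x' t t' y, δ x = some t → δ x' = some t' → y ∈ t.leaves → y ∈ t'.leaves → x = x'

def Reversible (M : TWT Γ S Q) : Prop :=
  ∀ a, LeafInjective (M.δ a) ∧ LeafInjective (M.δroot a)

end TWT

/-! λ-transducers and the translation of IAM configurations -/

/-- A λ-transducer `Tree(Γ) → Tree(S)`: a memory type `A`, transition terms
`trans a : A^(rk a) ⊸ A` and an output term `out : A ⊸ o`. -/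
structure LambdaTransducer (Γ S : RankedAlphabet) where
  memory : Ty
  trans : Γ.Letter → Term S
  out : Term S
  trans_typed : ∀ a, HasType [] (trans a) (Ty.arrows memory (Γ.rk a) memory)
  out_typed : HasType [] out (.arrow memory .o)

/-- The states before the bound on tapes and the conditions on terms are imposed:
`I`, `T(d,t,C,T)`, `U(d,t,C,T)`, `∇(T)` and `Δ(T)`. -/
inductive State (S : RankedAlphabet) : Type
  | I : State S
  | T (d : Polarity) (t : Term S) (C : Ctx S) (T : Tape) : State S
  | U (d : Polarity) (t : Term S) (C : Ctx S) (T : Tape) : State S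
  | nabla (T : Tape) : State S
  | delta (T : Tape) : State S

/-- Follow the path of a context, given from the root down to the hole, in the term `t` (`C` is
the context of `t` reached so far). The result is a subterm and its context. The last clause is
for paths that do not exist in `t`. -/
def followPath {S : RankedAlphabet} : List (Frame S) → Term S → Ctx S → Term S × Ctx S
  | .lam :: P, .lam t, C => followPath P t (.lam :: C)
  | .appL _ :: P, .app t u, C => followPath P t (.appL u :: C)
  | .appR _ :: P, .app t u, C => followPath P u (.appR t :: C)
  | .bang :: P, .bang t, C => followPath P t (.bang :: C)
  | .letArg _ :: P, .letb u t, C => followPath P u (.letArg t :: C)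
  | .letBody _ :: P, .letb u t, C => followPath P t (.letBody u :: C)
  | _, t, C => (t, C)

/-- Given a path, from the root down, in a term `t u₁ ⋯ uₖ`: if it enters one of the arguments
`uᵢ`, return `i` (numbered from `0`) and the rest of the path inside `uᵢ`. -/
def enterArg {S : RankedAlphabet} : (k : ℕ) → List (Frame S) → Option (Fin k × List (Frame S))
  | k + 1, .appR _ :: P => some (Fin.last k, P)
  | k + 1, .appL _ :: P => (enterArg k P).map fun r => (r.1.castSucc, r.2)
  | _, _ => none

/-- Given a path, from the root down, in `τ̂(t)`: the node `ν` of `τ` such that the subterm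
`τ̂'(t)`, for `τ'` the subtree of `τ` rooted at `ν`, is the smallest one of this form that
contains the endpoint of the path, together with the rest of the path inside `τ̂'(t)`. -/
def locate {Γ S : RankedAlphabet} :
    (τ : GroundTree Γ) → List (Frame S) → Node τ × List (Frame S)
  | .leaf e, _ => e.elim
  | .node a ts, P =>
    match enterArg (Γ.rk a) P with
    | some (i, P') => (.child i (locate (ts i) P').1, (locate (ts i) P').2)
    | none => (.root, P)

namespace LambdaTransducer
variable {Γ S : RankedAlphabet}

/-- `τ̂((t_a)_a)`: replace each letter of `τ` by its transition term. -/
def hat (L : LambdaTransducer Γ S) : GroundTree Γ → Term S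
  | .leaf e => e.elim
  | .node a ts => (L.trans a).apps (List.ofFn fun i => L.hat (ts i))

/-- The term `u τ̂((t_a)_a)`, whose normal form encodes the output on `τ`. -/
def program (L : LambdaTransducer Γ S) (τ : GroundTree Γ) : Term S := .app L.out (L.hat τ)

/-- `t_a ◊₁ ⋯ ◊ₖ` for `k = rk a`. -/
def marked (L : LambdaTransducer Γ S) (a : Γ.Letter) : Term S :=
  (L.trans a).apps (List.ofFn fun i : Fin (Γ.rk a) => .mark i)

/-- `H` bounds the length of all tapes that appear in the runs of the interaction abstract machine
on `u τ̂((t_a)_a)`, for all input trees `τ`. -/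
def TapeBound (L : LambdaTransducer Γ S) (H : ℕ) : Prop :=
  ∀ (τ : GroundTree Γ) (κ : IAMConfig (L.program τ)),
    (apaiam (L.program τ)).Reachable κ → κ.tape.length ≤ H

/-- The conditions that define the set of states, for tapes of length at most `H`. -/
def IsState (L : LambdaTransducer Γ S) (H : ℕ) : State S → Prop
  | .I => True
  | .T _ t C T => (∃ a, Ctx.plug C t = L.marked a) ∧ C ≠ [] ∧ (∀ i, t ≠ .mark i) ∧ T.length ≤ H
  | .U _ t C T => Ctx.plug C t = L.out ∧ T.length ≤ H
  | .nabla T => T.length ≤ H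
  | .delta T => T.length ≤ H

/-- The set `Q` of states. -/
abbrev Q (L : LambdaTransducer Γ S) (H : ℕ) : Type := {q : State S // L.IsState H q}

/-- The initial state. -/
def initState (L : LambdaTransducer Γ S) (H : ℕ) : L.Q H := ⟨.I, trivial⟩

/-- The translation `sim` of IAM configurations on `u τ̂((t_a)_a)`. -/
def sim (L : LambdaTransducer Γ S) (τ : GroundTree Γ) (κ : IAMConfig (L.program τ)) :
    TWTConfig (State S) τ :=
  match κ.ctx.reverse with
  -- the focus is inside `u`
  | .appL _ :: P => ⟨.U κ.dir κ.focus P.reverse κ.tape, .root, .stay⟩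
  -- the focus is inside `τ̂`
  | .appR _ :: P =>
    let ν := (locate τ P).1
    match (locate τ P).2, κ.dir, ν.parent with
    | [], .down, none => ⟨.nabla κ.tape, ν, .stay⟩
    | [], .down, some _ => ⟨.nabla κ.tape, ν, .parent⟩
    | [], .up, none => ⟨.delta κ.tape, ν, .stay⟩
    | [], .up, some ⟨ξ, i⟩ => ⟨.delta κ.tape, ξ, .child i⟩
    | f :: P', d, _ =>
      let r := followPath (f :: P') (L.marked ν.label) []
      ⟨.T d r.1 r.2 κ.tape, ν, .stay⟩
  -- the focus is the whole term
  | _ => ⟨.I, .root, .stay⟩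

end LambdaTransducer

end LamTWT

namespace LamTWT

/-! ### Relabelling the leaves of trees -/

namespace Tree
variable {S : RankedAlphabet} {X Y Z W : Type}

/-! The term `u τ̂` is glued from closed pieces: `u`, and one copy of `t_a` for each node of the
input. Since the pieces are closed, a variable and its binder always lie in the same piece, so a
machine step either stays in one piece or crosses the boundary between two adjacent ones. Replacing
the arguments of a copy by formal constants `◊ᵢ` therefore loses nothing: a step in `t_a ◊₁ ⋯ ◊ₖ`,
or in `u (t_a ◊₁ ⋯ ◊ₖ)` at the root, commutes with putting the actual subterms and the surrounding
context back (`rawStep_lift`). The only exceptions are configurations about to enter a `◊ᵢ` or to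
leave the term, and these are the ones that become moves to a child or to the parent. A boundary has
two names, `◊ᵢ` in the copy at a node and the whole term in the copy at its `i`-th child; the states
`∇` and `Δ` pass from one to the other (`nodeSub_childAt`, `hatCtx_childAt`). The transition
functions are thus "decode, perform one local step, encode" (`localStep`). Every reachable
configuration is decoded correctly (`exists_describes`), and every encoded result is the translation
of its configuration (`sim_eq_move`, `sim_eq_moveRoot`).

Tapes are bounded because of an invariant (`RawConfig.Typed.of_step`): the tape is the address of an
occurrence of `o` or `!o` in the type of the focus, positive exactly when the token goes down. So
its length is at most the height of that type. By the subformula property of normal forms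
(`HasType.subformula`), `u` and the `t_a` have derivations whose types are almost purely affine of
height at most some `N`. The term `u τ̂` is not normal, but the pieces are put together by
applications along the memory type, so the same `N` serves for all `τ`. Restricting `!` to `o`
matters when the token jumps from a variable to the argument of its `let`: `o` and `!o` both have
the empty address.

For reversibility, a step on a term typed without `!` has an explicit left inverse `rawPred`,
because an affine variable has at most one occurrence (`HasTypeIn.occ_plug`). A leaf of a transition
map decodes to one configuration, hence to one predecessor, and the encoding of sources is injective
(`entry_inj`, `rootEntry_inj`). -/

theorem leaves_map (f : X → Y) (t : Tree S X) : (t.map f).leaves = t.leaves.map f := by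
  induction t with
  | leaf x => rfl
  | node c ts ih => simp only [map, leaves, ih, List.map_flatten, List.map_ofFn, Function.comp_def]

theorem mem_leaves_node {c : S.Letter} {ts : Fin (S.rk c) → Tree S X} {x : X} :
    x ∈ (node c ts).leaves ↔ ∃ i, x ∈ (ts i).leaves := by
  simp [leaves]

/-- A preimage is chosen separately at each leaf; this turns a tree of configurations into a tree of
states and moves. -/
theorem exists_map_eq (g : Y → Z) (h : X → Z) (t : Tree S X)
    (H : ∀ x ∈ t.leaves, ∃ y, g y = h x) : ∃ t' : Tree S Y, t'.map g = t.map h := by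
  induction t with
  | leaf x =>
    obtain ⟨y, hy⟩ := H x (by simp [leaves])
    exact ⟨.leaf y, by simp [map, hy]⟩
  | node c ts ih =>
    choose t' ht' using fun i => ih i fun x hx => H x (mem_leaves_node.2 ⟨i, hx⟩)
    exact ⟨.node c t', by simp [map, ht']⟩

/-- If `s` and `t'` have the shape of `t`, with related leaves, relabellings of `s` and `t'` that
agree on leaves at the same position are equal. -/
theorem map_eq_map_of_common {V : Type} {a : X → V} {b : Y → V} {g : Z → W} {h : Y → W} {U : Type}
    {k : X → U} {l : Z → U} (t : Tree S Y) :
    ∀ (s : Tree S X) (t' : Tree S Z), s.map a = t.map b → t'.map g = t.map h →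
      (∀ x ∈ s.leaves, ∀ y ∈ t.leaves, ∀ z ∈ t'.leaves, a x = b y → g z = h y → k x = l z) →
      s.map k = t'.map l := by
  induction t with
  | leaf y =>
    intro s t' h1 h2 H
    cases s <;> cases t' <;> simp_all [map, leaves]
  | node c ts ih =>
    intro s t' h1 h2 H
    cases s with
    | leaf x => simp [map] at h1
    | node c1 ss =>
      cases t' with
      | leaf x => simp [map] at h2
      | node c2 tt =>
        simp only [map, node.injEq] at h1 h2
        obtain ⟨rfl, h1⟩ := h1
        obtain ⟨rfl, h2⟩ := h2
        simp only [map, node.injEq, heq_eq_eq, true_and] at h1 h2 ⊢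
        funext i
        exact ih i _ _ (congrFun h1 i) (congrFun h2 i) fun x hx y hy z hz =>
          H x (mem_leaves_node.2 ⟨i, hx⟩) y (mem_leaves_node.2 ⟨i, hy⟩) z (mem_leaves_node.2 ⟨i, hz⟩)

end Tree

/-! ### Configurations that do not record the ambient term -/

variable {S Γ : RankedAlphabet}

/-- A configuration of the interaction abstract machine, without the constraint on the term. -/
structure RawConfig (S : RankedAlphabet) where
  dir : Polarity
  focus : Term S
  ctx : Ctx S
  tape : Tape

/-- The term in which a configuration is located. -/
def RawConfig.term (c : RawConfig S) : Term S := Ctx.plug c.ctx c.focus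

def IAMConfig.raw {v : Term S} (κ : IAMConfig v) : RawConfig S :=
  ⟨κ.dir, κ.focus, κ.ctx, κ.tape⟩

/-- Steps in the direction `↓`. -/
def downStep : Term S → Ctx S → Tape → Option (Tree S (RawConfig S))
  | .app t u, C, T => some (.leaf ⟨.down, t, .appL u :: C, .p :: T⟩)
  | .lam _, _, [] => none
  | .lam t, C, .p :: T => some (.leaf ⟨.down, t, .lam :: C, T⟩)
  | .lam t, C, .c :: T =>
    (t.occ 0).map fun r => .leaf ⟨.up, .var r.2, r.1 ++ .lam :: C, T⟩
  | .var n, C, T =>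
    match Ctx.binder n C with
    | some (D, .lam, C') => some (.leaf ⟨.up, .lam (Ctx.plug D (.var n)), C', .c :: T⟩)
    | some (D, .letBody u, C') =>
      some (.leaf ⟨.down, u, .letArg (Ctx.plug D (.var n)) :: C', T⟩)
    | _ => none
  | .const c, C, T =>
    if T.take (S.rk c) = List.replicate (S.rk c) Sym.p then
      some (.node c fun i =>
        .leaf ⟨.up, .const c, C, List.replicate i.val Sym.p ++ .c :: T.drop (S.rk c)⟩)
    else none
  | .letb u t, C, T => some (.leaf ⟨.down, t, .letBody u :: C, T⟩)
  | .bang t, C, T => some (.leaf ⟨.down, t, .bang :: C, T⟩)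
  | .mark _, _, _ => none

/-- Steps in the direction `↑`. -/
def upStep (t : Term S) : Ctx S → Tape → Option (Tree S (RawConfig S))
  | .appL u :: C, .p :: T => some (.leaf ⟨.up, .app t u, C, T⟩)
  | .appL u :: C, .c :: T => some (.leaf ⟨.down, u, .appR t :: C, T⟩)
  | .appR r :: C, T => some (.leaf ⟨.down, r, .appL t :: C, .c :: T⟩)
  | .lam :: C, T => some (.leaf ⟨.up, .lam t, C, .p :: T⟩)
  | .letBody u :: C, T => some (.leaf ⟨.up, .letb u t, C, T⟩)
  | _, _ => none

def rawStep (c : RawConfig S) : Option (Tree S (RawConfig S)) :=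
  match c.dir with
  | .down => downStep c.focus c.ctx c.tape
  | .up => upStep c.focus c.ctx c.tape

/-- Forgetting the equation `C⟨t⟩ = v` loses no information about steps, and lets configurations in
different terms be compared. -/
theorem iamStep_map_raw {v : Term S} (κ : IAMConfig v) :
    (iamStep v κ).map (Tree.map IAMConfig.raw) = rawStep κ.raw := by
  obtain ⟨d, t, C, T, h⟩ := κ
  cases d with
  | down =>
    cases t with
    | const c =>
      simp only [iamStep, rawStep, IAMConfig.raw, downStep]
      split_ifs <;> rfl
    | mark i => rfl
    | var n =>
      simp only [iamStep, rawStep, IAMConfig.raw, downStep]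
      split <;> split <;> simp_all [Tree.map, IAMConfig.raw]
    | lam t =>
      match T with
      | [] => rfl
      | .p :: T => rfl
      | .c :: T =>
        simp only [iamStep, rawStep, IAMConfig.raw, downStep]
        split <;> simp_all [Tree.map, IAMConfig.raw]
    | app t u => rfl
    | bang t => rfl
    | letb u t => rfl
  | up =>
    match C, T with
    | [], _ => rfl
    | .appL u :: C, [] => rfl
    | .appL u :: C, .p :: T => rfl
    | .appL u :: C, .c :: T => rfl
    | .appR r :: C, T => rfl
    | .lam :: C, T => rfl
    | .bang :: C, T => rfl
    | .letArg _ :: C, T => rfl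
    | .letBody u :: C, T => rfl

/-! Substitution for the formal constants -/

/-- Replace every formal constant `◊ᵢ` by `σ i`. -/
def Term.sub (σ : ℕ → Term S) : Term S → Term S
  | .const c => .const c
  | .mark i => σ i
  | .var n => .var n
  | .lam t => .lam (t.sub σ)
  | .app t u => .app (t.sub σ) (u.sub σ)
  | .bang t => .bang (t.sub σ)
  | .letb u t => .letb (u.sub σ) (t.sub σ)

def Frame.sub (σ : ℕ → Term S) : Frame S → Frame S
  | .lam => .lam
  | .appL u => .appL (u.sub σ)
  | .appR t => .appR (t.sub σ)
  | .bang => .bang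
  | .letArg t => .letArg (t.sub σ)
  | .letBody u => .letBody (u.sub σ)

def Ctx.sub (σ : ℕ → Term S) (C : Ctx S) : Ctx S := List.map (Frame.sub σ) C

@[simp] theorem Ctx.sub_nil (σ : ℕ → Term S) : Ctx.sub σ [] = [] := rfl
@[simp] theorem Ctx.sub_cons (σ : ℕ → Term S) (f : Frame S) (C : Ctx S) :
    Ctx.sub σ (f :: C) = f.sub σ :: Ctx.sub σ C := rfl
@[simp] theorem Ctx.sub_append (σ : ℕ → Term S) (C D : Ctx S) :
    Ctx.sub σ (C ++ D) = Ctx.sub σ C ++ Ctx.sub σ D := List.map_append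
@[simp] theorem Ctx.sub_eq_nil (σ : ℕ → Term S) (C : Ctx S) : Ctx.sub σ C = [] ↔ C = [] :=
  List.map_eq_nil_iff

theorem Frame.plug_sub (σ : ℕ → Term S) (f : Frame S) (t : Term S) :
    (f.plug t).sub σ = (f.sub σ).plug (t.sub σ) := by cases f <;> rfl

theorem Ctx.plug_sub (σ : ℕ → Term S) (C : Ctx S) : ∀ t : Term S,
    (Ctx.plug C t).sub σ = Ctx.plug (Ctx.sub σ C) (t.sub σ) := by
  induction C with
  | nil => intro t; rfl
  | cons f C ih => intro t; simp only [Ctx.plug, Ctx.sub_cons, ih, Frame.plug_sub]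

/-- Substitution acts on the components of a plugged term separately, so they are fixed when the
whole is. It applies to positions in `u` and `t_a`, which contain no formal constant. -/
theorem Ctx.sub_eq_self_of_plug (σ : ℕ → Term S) (C : Ctx S) : ∀ t : Term S,
    (Ctx.plug C t).sub σ = Ctx.plug C t → Ctx.sub σ C = C ∧ t.sub σ = t := by
  induction C with
  | nil => intro t h; exact ⟨rfl, h⟩
  | cons f C ih =>
    intro t h
    obtain ⟨h1, h2⟩ := ih _ h
    cases f <;> simp_all [Frame.plug, Frame.sub, Term.sub]

/-- All variables of `t` have an index below `n` at the root of `t`. -/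
def Term.Closed : ℕ → Term S → Prop
  | _, .const _ => True
  | _, .mark _ => True
  | n, .var m => m < n
  | n, .lam t => t.Closed (n + 1)
  | n, .app t u => t.Closed n ∧ u.Closed n
  | n, .bang t => t.Closed n
  | n, .letb u t => u.Closed n ∧ t.Closed (n + 1)

theorem Term.Closed.occ_eq_none {t : Term S} : ∀ {n m : ℕ}, t.Closed n → n ≤ m →
    t.occ m = none := by
  induction t with
  | const c => intros; rfl
  | mark i => intros; rfl
  | var k => intro n m h hm; simp only [Term.Closed] at h; simp only [Term.occ]; rw [if_neg (by omega)]
  | lam t ih => intro n m h hm; simp [Term.occ, ih (n := n + 1) (m := m + 1) h (by omega)]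
  | app t u iht ihu => intro n m h hm; simp [Term.occ, iht h.1 hm, ihu h.2 hm]
  | bang t ih => intro n m h hm; simp [Term.occ, ih (n := n) (m := m) h hm]
  | letb u t ihu iht =>
    intro n m h hm
    simp [Term.occ, ihu h.1 hm, iht (n := n + 1) (m := m + 1) h.2 (by omega)]

/-- The substituted terms are closed, so they offer no new occurrence and the search ends at the
same place. -/
theorem Term.occ_sub {σ : ℕ → Term S} (hσ : ∀ i, (σ i).Closed 0) (t : Term S) : ∀ n : ℕ,
    (t.sub σ).occ n = (t.occ n).map fun r => (Ctx.sub σ r.1, r.2) := by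
  induction t with
  | const c => intro n; rfl
  | mark i => intro n; simpa [Term.occ, Term.sub] using (hσ i).occ_eq_none (Nat.zero_le n)
  | var k => intro n; simp only [Term.occ, Term.sub]; split_ifs <;> rfl
  | lam t ih =>
    intro n; simp [Term.occ, Term.sub, ih, Function.comp_def, Frame.sub]
  | app t u iht ihu =>
    intro n
    cases h1 : t.occ n <;> cases h2 : u.occ n <;>
      simp [Term.occ, Term.sub, iht, ihu, h1, h2, Frame.sub]
  | bang t ih => intro n; simp [Term.occ, Term.sub, ih, Function.comp_def, Frame.sub]
  | letb u t ihu iht =>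
    intro n
    cases h1 : u.occ n <;> cases h2 : t.occ (n + 1) <;>
      simp [Term.occ, Term.sub, iht, ihu, h1, h2, Frame.sub]

theorem Frame.binds_sub (σ : ℕ → Term S) (f : Frame S) : (f.sub σ).binds = f.binds := by
  cases f <;> rfl

/-- The search for a binder looks only at which frames bind, and here it stops before reaching `C₀`.
-/
theorem Ctx.binder_sub_append (σ : ℕ → Term S) (C₀ : Ctx S) (C : Ctx S) :
    ∀ (n : ℕ) (D : Ctx S) (f : Frame S) (C' : Ctx S), Ctx.binder n C = some (D, f, C') →
      Ctx.binder n (Ctx.sub σ C ++ C₀) = some (Ctx.sub σ D, f.sub σ, Ctx.sub σ C' ++ C₀) := by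
  induction C with
  | nil => intro n D f C' h; simp [Ctx.binder] at h
  | cons g C ih =>
    intro n D f C' h
    rw [Ctx.sub_cons, List.cons_append]
    unfold Ctx.binder at h ⊢
    rw [Frame.binds_sub]
    rcases hb : g.binds with _ | _
    · simp only [hb] at h ⊢
      obtain ⟨⟨D', f', C''⟩, h1, h2⟩ := Option.map_eq_some_iff.1 h
      simp only [Prod.mk.injEq] at h2
      obtain ⟨rfl, rfl, rfl⟩ := h2
      simp [ih _ _ _ _ h1]
    · cases n with
      | zero =>
        simp only [hb, Option.some.injEq, Prod.mk.injEq] at h ⊢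
        obtain ⟨rfl, rfl, rfl⟩ := h
        simp
      | succ n =>
        simp only [hb] at h ⊢
        obtain ⟨⟨D', f', C''⟩, h1, h2⟩ := Option.map_eq_some_iff.1 h
        simp only [Prod.mk.injEq] at h2
        obtain ⟨rfl, rfl, rfl⟩ := h2
        simp [ih _ _ _ _ h1]

/-- The number of variables bound by a context in its hole. -/
def Ctx.depth : Ctx S → ℕ
  | [] => 0
  | f :: C => (if f.binds then 1 else 0) + Ctx.depth C

theorem Term.Closed.of_plug (C : Ctx S) : ∀ {t : Term S} {n : ℕ}, (Ctx.plug C t).Closed n →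
    t.Closed (n + Ctx.depth C) := by
  induction C with
  | nil => intro t n h; exact h
  | cons f C ih =>
    intro t n h
    have := ih h
    cases f <;> simp_all [Frame.plug, Term.Closed, Ctx.depth, Frame.binds,
      Nat.add_comm, Nat.add_left_comm]

/-- With `Term.Closed.of_plug`, this places the binder of any variable of a closed piece inside that
piece, so a variable step never crosses a boundary. -/
theorem Ctx.exists_binder (C : Ctx S) : ∀ n : ℕ, n < Ctx.depth C →
    ∃ D f C', Ctx.binder n C = some (D, f, C') := by
  induction C with
  | nil => intro n h; simp [Ctx.depth] at h
  | cons g C ih =>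
    intro n h
    unfold Ctx.binder
    unfold Ctx.depth at h
    rcases hb : g.binds with _ | _
    · obtain ⟨D, f, C', h1⟩ := ih n (by simpa [hb] using h)
      exact ⟨_, _, _, by simp [h1]; exact ⟨rfl, rfl, rfl⟩⟩
    · cases n with
      | zero => exact ⟨_, _, _, rfl⟩
      | succ n =>
        obtain ⟨D, f, C', h1⟩ := ih n (by simp [hb] at h; omega)
        exact ⟨_, _, _, by simp [h1]; exact ⟨rfl, rfl, rfl⟩⟩

/-- Substitute for the formal constants, in a larger context. -/
def RawConfig.lift (σ : ℕ → Term S) (C₀ : Ctx S) (c : RawConfig S) : RawConfig S :=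
  ⟨c.dir, c.focus.sub σ, Ctx.sub σ c.ctx ++ C₀, c.tape⟩

/-- A step that is not an entry in a formal constant or an exit from the term commutes with
substitution in a larger context. -/
theorem rawStep_lift {σ : ℕ → Term S} (hσ : ∀ i, (σ i).Closed 0) (C₀ : Ctx S) (c : RawConfig S)
    (hc : c.term.Closed 0) (hdown : c.dir = .down → ∀ i, c.focus ≠ .mark i)
    (hup : c.dir = .up → c.ctx = [] → C₀ = []) :
    rawStep (c.lift σ C₀) = (rawStep c).map (Tree.map (RawConfig.lift σ C₀)) := by
  obtain ⟨d, t, C, T⟩ := c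
  cases d with
  | down =>
    cases t with
    | const c =>
      simp only [RawConfig.lift, rawStep, downStep, Term.sub]
      split_ifs <;> rfl
    | mark i => exact absurd rfl (hdown rfl i)
    | var n =>
      have h := Term.Closed.of_plug C hc
      obtain ⟨D, f, C', h1⟩ := Ctx.exists_binder C n (by simpa [Term.Closed] using h)
      have h2 := Ctx.binder_sub_append σ C₀ C n D f C' h1
      simp only [RawConfig.lift, rawStep, downStep, Term.sub, h1, h2]
      cases f <;> simp [Frame.sub, Tree.map, RawConfig.lift, Term.sub, Ctx.plug_sub]
    | lam t =>
      match T with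
      | [] => rfl
      | .p :: T => rfl
      | .c :: T =>
        simp only [RawConfig.lift, rawStep, downStep, Term.sub, Term.occ_sub hσ]
        cases t.occ 0 <;> simp [Tree.map, RawConfig.lift, Term.sub, Frame.sub]
    | app t u => rfl
    | bang t => rfl
    | letb u t => rfl
  | up =>
    match C, T with
    -- At the hole, the next step would depend on the frames of `C₀`.
    | [], _ => obtain rfl := hup rfl rfl; rfl
    | .appL u :: C, [] => rfl
    | .appL u :: C, .p :: T => rfl
    | .appL u :: C, .c :: T => rfl
    | .appR r :: C, T => rfl
    | .lam :: C, T => rfl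
    | .bang :: C, T => rfl
    | .letArg _ :: C, T => rfl
    | .letBody u :: C, T => rfl

/-- Shape of the configurations after a step. -/
theorem rawStep_target {c c' : RawConfig S} {t : Tree S (RawConfig S)} (h : rawStep c = some t)
    (h' : c' ∈ t.leaves) : c'.term = c.term ∧ (c'.dir = .down → c'.ctx ≠ []) ∧
      (c'.dir = .up → ∀ i, c'.focus ≠ .mark i) := by
  obtain ⟨d, r, C, T⟩ := c
  cases d with
  | down =>
    cases r with
    | const c =>
      simp only [rawStep, downStep] at h
      split_ifs at h
      obtain rfl := Option.some.inj h
      obtain ⟨i, hi⟩ := Tree.mem_leaves_node.1 h'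
      simp only [Tree.leaves, List.mem_singleton] at hi
      subst hi
      simp [RawConfig.term]
    | mark i => simp [rawStep, downStep] at h
    | var n =>
      simp only [rawStep, downStep] at h
      split at h
      · rename_i D C' hb
        obtain rfl := Option.some.inj h
        simp only [Tree.leaves, List.mem_singleton] at h'
        subst h'
        simp [RawConfig.term, Ctx.binder_eq _ _ _ _ _ hb, Ctx.plug_append, Ctx.plug, Frame.plug]
      · rename_i D u C' hb
        obtain rfl := Option.some.inj h
        simp only [Tree.leaves, List.mem_singleton] at h'
        subst h'
        simp [RawConfig.term, Ctx.binder_eq _ _ _ _ _ hb, Ctx.plug_append, Ctx.plug, Frame.plug]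
      · simp at h
    | lam t =>
      match T with
      | [] => simp [rawStep, downStep] at h
      | .p :: T =>
        obtain rfl := Option.some.inj h
        simp only [Tree.leaves, List.mem_singleton] at h'
        subst h'
        simp [RawConfig.term, Ctx.plug, Frame.plug]
      | .c :: T =>
        simp only [rawStep, downStep, Option.map_eq_some_iff] at h
        obtain ⟨r, hr, rfl⟩ := h
        simp only [Tree.leaves, List.mem_singleton] at h'
        subst h'
        simp [RawConfig.term, Ctx.plug, Frame.plug, Ctx.plug_append, Term.plug_occ _ _ _ _ hr]
    | app t u | bang t | letb u t =>
      obtain rfl := Option.some.inj h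
      simp only [Tree.leaves, List.mem_singleton] at h'
      subst h'
      simp [RawConfig.term, Ctx.plug, Frame.plug]
  | up =>
    match C, T with
    | [], _ | .appL u :: C, [] | .bang :: C, T | .letArg _ :: C, T => simp [rawStep, upStep] at h
    | .appL u :: C, .p :: T | .appL u :: C, .c :: T | .appR r :: C, T | .lam :: C, T
    | .letBody u :: C, T =>
      obtain rfl := Option.some.inj h
      simp only [Tree.leaves, List.mem_singleton] at h'
      subst h'
      simp [RawConfig.term, Ctx.plug, Frame.plug]


/-! Typings in which every type satisfies a predicate -/

/-- Typing judgements all of whose types satisfy `P`, where the formal constants have type `m`. -/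
inductive HasTypeIn (P : Ty → Prop) (m : Ty) : List Hyp → Term S → Ty → Prop
  | const (Δ : List Hyp) (c : S.Letter) : P (Ty.arrows .o (S.rk c) .o) →
      HasTypeIn P m Δ (.const c) (Ty.arrows .o (S.rk c) .o)
  | mark (Δ : List Hyp) (i : ℕ) : P m → HasTypeIn P m Δ (.mark i) m
  | affVar {Δ : List Hyp} {n : ℕ} {A : Ty} : P A → Δ[n]? = some (.aff A) →
      HasTypeIn P m Δ (.var n) A
  | unrVar {Δ : List Hyp} {n : ℕ} {A : Ty} : P A → Δ[n]? = some (.unr A) →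
      HasTypeIn P m Δ (.var n) A
  | lam {Δ : List Hyp} {t : Term S} {A B : Ty} : P (.arrow A B) →
      HasTypeIn P m (.aff A :: Δ) t B → HasTypeIn P m Δ (.lam t) (.arrow A B)
  | app {Δ Δ₁ Δ₂ : List Hyp} {t u : Term S} {A B : Ty} : P B → Split Δ Δ₁ Δ₂ →
      HasTypeIn P m Δ₁ t (.arrow A B) → HasTypeIn P m Δ₂ u A → HasTypeIn P m Δ (.app t u) B
  | bang {Δ : List Hyp} {t : Term S} {A : Ty} : P (.bang A) →
      HasTypeIn P m (Δ.map Hyp.dropAffine) t A → HasTypeIn P m Δ (.bang t) (.bang A)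
  | letb {Δ Δ₁ Δ₂ : List Hyp} {u t : Term S} {A B : Ty} : P B → Split Δ Δ₁ Δ₂ →
      HasTypeIn P m Δ₁ u (.bang A) → HasTypeIn P m (.unr A :: Δ₂) t B →
      HasTypeIn P m Δ (.letb u t) B

theorem HasTypeIn.prop {P : Ty → Prop} {m : Ty} {Δ : List Hyp} {t : Term S} {A : Ty}
    (h : HasTypeIn P m Δ t A) : P A := by cases h <;> assumption

/-- `P` is inherited by the immediate subformulas. -/
structure SubformulaClosed (P : Ty → Prop) : Prop where
  arrow {A B : Ty} : P (.arrow A B) → P A ∧ P B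
  bang {A : Ty} : P (.bang A) → P A

/-- The types that occur in a hypothesis satisfy `P`. -/
def Hyp.In (P : Ty → Prop) : Hyp → Prop
  | .unr A => P A
  | .aff A => P A
  | .absent => True

theorem Split.forall_in {P : Ty → Prop} {Δ Δ₁ Δ₂ : List Hyp} (h : Split Δ Δ₁ Δ₂)
    (hΔ : ∀ x ∈ Δ, Hyp.In P x) : (∀ x ∈ Δ₁, Hyp.In P x) ∧ ∀ x ∈ Δ₂, Hyp.In P x := by
  induction h <;> simp_all [Hyp.In]

theorem Split.get {Δ Δ₁ Δ₂ : List Hyp} (h : Split Δ Δ₁ Δ₂) : ∀ n : ℕ,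
    (Δ[n]? = none ∧ Δ₁[n]? = none ∧ Δ₂[n]? = none) ∨
    (∃ A, Δ[n]? = some (.unr A) ∧ Δ₁[n]? = some (.unr A) ∧ Δ₂[n]? = some (.unr A)) ∨
    (∃ A, Δ[n]? = some (.aff A) ∧ Δ₁[n]? = some (.aff A) ∧ Δ₂[n]? = some .absent) ∨
    (∃ A, Δ[n]? = some (.aff A) ∧ Δ₁[n]? = some .absent ∧ Δ₂[n]? = some (.aff A)) ∨
    (Δ[n]? = some .absent ∧ Δ₁[n]? = some .absent ∧ Δ₂[n]? = some .absent) := by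
  induction h with
  | nil => intro n; simp
  | unr A h ih => intro n; cases n with
    | zero => simp
    | succ n => simpa using ih n
  | left A h ih => intro n; cases n with
    | zero => simp
    | succ n => simpa using ih n
  | right A h ih => intro n; cases n with
    | zero => simp
    | succ n => simpa using ih n
  | absent h ih => intro n; cases n with
    | zero => simp
    | succ n => simpa using ih n

theorem Split.length {Δ Δ₁ Δ₂ : List Hyp} (h : Split Δ Δ₁ Δ₂) :
    Δ₁.length = Δ.length ∧ Δ₂.length = Δ.length := by
  induction h <;> simp_all

theorem Hyp.dropAffine_eq_unr {x : Hyp} {A : Ty} : x.dropAffine = .unr A ↔ x = .unr A := by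
  cases x <;> simp [Hyp.dropAffine]

theorem Hyp.dropAffine_ne_aff {x : Hyp} {A : Ty} : x.dropAffine ≠ .aff A := by
  cases x <;> simp [Hyp.dropAffine]

/-- Subformula property of normal forms. If the hypotheses and the types of the constants satisfy
`P`, then so does the type of a normal term that is neither `L⟨λx. t⟩` nor `L⟨!t⟩`; and if the type
of a normal term satisfies `P`, then so do all types in a derivation. -/
theorem HasType.subformula {P : Ty → Prop} (m : Ty) (hP : SubformulaClosed P)
    (hc : ∀ c : S.Letter, P (Ty.arrows .o (S.rk c) .o)) {Δ : List Hyp} {t : Term S} {A : Ty}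
    (h : HasType Δ t A) : t.Normal → (∀ x ∈ Δ, Hyp.In P x) →
      ((¬ t.IsLetsLam → ¬ t.IsLetsBang → P A) ∧ (P A → HasTypeIn P m Δ t A) ∧
        (t.IsLetsLam → ∃ B C, A = .arrow B C) ∧ (t.IsLetsBang → ∃ B, A = .bang B)) := by
  induction h with
  | const Δ c =>
    intro _ _
    exact ⟨fun _ _ => hc c, fun h => .const _ _ h, by simp [Term.IsLetsLam, Term.stripLets],
      by simp [Term.IsLetsBang, Term.stripLets]⟩
  | affVar h =>
    intro _ hΔ
    exact ⟨fun _ _ => hΔ _ (List.mem_of_getElem? h), fun h' => .affVar h' h,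
      by simp [Term.IsLetsLam, Term.stripLets], by simp [Term.IsLetsBang, Term.stripLets]⟩
  | unrVar h =>
    intro _ hΔ
    exact ⟨fun _ _ => hΔ _ (List.mem_of_getElem? h), fun h' => .unrVar h' h,
      by simp [Term.IsLetsLam, Term.stripLets], by simp [Term.IsLetsBang, Term.stripLets]⟩
  | lam h ih =>
    intro hn hΔ
    refine ⟨fun h1 => absurd ⟨_, rfl⟩ h1, fun hAB => .lam hAB ?_, fun _ => ⟨_, _, rfl⟩,
      by simp [Term.IsLetsBang, Term.stripLets]⟩
    refine (ih hn ?_).2.1 (hP.arrow hAB).2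
    simpa [Hyp.In] using ⟨(hP.arrow hAB).1, hΔ⟩
  | app hs ht hu iht ihu =>
    intro hn hΔ
    obtain ⟨h1, h2⟩ := hs.forall_in hΔ
    obtain ⟨t1, t2, _, t4⟩ := iht hn.1 h1
    obtain ⟨_, u2, _⟩ := ihu hn.2.1 h2
    -- Normality excludes `L⟨λx. t⟩` and the arrow type excludes `L⟨!t⟩`, so the function is neutral
    -- and its type satisfies `P`.
    have hAB := t1 hn.2.2 fun hb => by obtain ⟨B, hB⟩ := t4 hb; cases hB
    obtain ⟨hA, hB⟩ := hP.arrow hAB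
    exact ⟨fun _ _ => hB, fun _ => .app hB hs (t2 hAB) (u2 hA),
      by simp [Term.IsLetsLam, Term.stripLets], by simp [Term.IsLetsBang, Term.stripLets]⟩
  | @bang Δ t A h ih =>
    intro hn hΔ
    refine ⟨fun _ h1 => absurd ⟨_, rfl⟩ h1, fun hA => .bang hA ?_,
      by simp [Term.IsLetsLam, Term.stripLets], fun _ => ⟨_, rfl⟩⟩
    refine (ih hn ?_).2.1 (hP.bang hA)
    intro x hx
    obtain ⟨y, hy, rfl⟩ := List.mem_map.1 hx
    have := hΔ y hy
    cases y <;> first | exact this | trivial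
  | letb hs hu ht ihu iht =>
    intro hn hΔ
    obtain ⟨h1, h2⟩ := hs.forall_in hΔ
    obtain ⟨u1, u2, u3, _⟩ := ihu hn.1 h1
    -- Dually to applications, normality excludes a box and the type `!A` excludes an abstraction.
    have hA := u1 (fun hb => by obtain ⟨B, C, hB⟩ := u3 hb; cases hB) hn.2.2
    obtain ⟨t1, t2, t3, t4⟩ := iht hn.2.1 (by simpa [Hyp.In] using ⟨hP.bang hA, h2⟩)
    exact ⟨t1, fun hB => .letb hB hs (u2 hA) (t2 hB), t3, t4⟩

/-- Formal constants have no typing rule, so there is nothing to replace. -/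
theorem HasType.sub_eq {Δ : List Hyp} {t : Term S} {A : Ty} (h : HasType Δ t A)
    (σ : ℕ → Term S) : t.sub σ = t := by
  induction h <;> simp_all [Term.sub]

theorem HasTypeIn.closed {P : Ty → Prop} {m : Ty} {Δ : List Hyp} {t : Term S} {A : Ty}
    (h : HasTypeIn P m Δ t A) : t.Closed Δ.length := by
  induction h with
  | const | mark => trivial
  | affVar _ h | unrVar _ h => exact (List.getElem?_eq_some_iff.1 h).1
  | lam _ _ ih => exact ih
  | app _ hs _ _ iht ihu => exact ⟨hs.length.1 ▸ iht, hs.length.2 ▸ ihu⟩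
  | bang _ _ ih => simpa [Term.Closed] using ih
  | letb _ hs _ _ iht ihu => exact ⟨hs.length.1 ▸ iht, by simpa [hs.length.2] using ihu⟩

/-- An absent hypothesis stays absent in both halves of a split and inside a box. Whenever a split
gives an affine variable to one side, this rules out occurrences on the other. -/
theorem HasTypeIn.occ_eq_none {P : Ty → Prop} {m : Ty} {Δ : List Hyp} {t : Term S} {A : Ty}
    (h : HasTypeIn P m Δ t A) : ∀ n, Δ[n]? = some .absent → t.occ n = none := by
  induction h with
  | const | mark => intros; rfl
  | affVar _ h | unrVar _ h =>
    intro k hk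
    simp only [Term.occ]
    split_ifs with hh
    · subst hh; rw [h] at hk; cases hk
    · rfl
  | lam _ _ ih => intro n hn; simp [Term.occ, ih (n + 1) (by simpa using hn)]
  | app _ hs _ _ iht ihu =>
    intro n hn
    have h1 := hs.get n
    simp only [hn] at h1
    simp at h1
    simp [Term.occ, iht n h1.1, ihu n h1.2]
  | bang _ _ ih =>
    intro n hn
    simp [Term.occ, ih n (by simp [hn, Hyp.dropAffine])]
  | letb _ hs _ _ iht ihu =>
    intro n hn
    have h1 := hs.get n
    simp only [hn] at h1
    simp at h1
    simp [Term.occ, iht n h1.1, ihu (n + 1) (by simpa using h1.2)]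

/-- Subterms of typed terms are typed. -/
theorem HasTypeIn.of_plug {P : Ty → Prop} {m : Ty} (C : Ctx S) : ∀ {Δ : List Hyp} {t : Term S}
    {A : Ty}, HasTypeIn P m Δ (Ctx.plug C t) A → ∃ Δ' B, HasTypeIn P m Δ' t B := by
  induction C with
  | nil => intro Δ t A h; exact ⟨_, _, h⟩
  | cons f C ih =>
    intro Δ t A h
    obtain ⟨Δ', B, h'⟩ := ih h
    cases f <;> cases h' <;> exact ⟨_, _, by assumption⟩

/-! Typed contexts -/

/-- `CtxTyped P m C Δ A`: the context `C` yields closed terms of type `o` when filled with terms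
of type `A` in the typing context `Δ`. -/
inductive CtxTyped (P : Ty → Prop) (m : Ty) : Ctx S → List Hyp → Ty → Prop
  | nil : CtxTyped P m [] [] .o
  | lam {C : Ctx S} {Δ : List Hyp} {A B : Ty} : P (.arrow A B) →
      CtxTyped P m C Δ (.arrow A B) → CtxTyped P m (.lam :: C) (.aff A :: Δ) B
  | appL {C : Ctx S} {Δ Δ₁ Δ₂ : List Hyp} {u : Term S} {A B : Ty} : P B → Split Δ Δ₁ Δ₂ →
      HasTypeIn P m Δ₂ u A → CtxTyped P m C Δ B →
      CtxTyped P m (.appL u :: C) Δ₁ (.arrow A B)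
  | appR {C : Ctx S} {Δ Δ₁ Δ₂ : List Hyp} {t : Term S} {A B : Ty} : P B → Split Δ Δ₁ Δ₂ →
      HasTypeIn P m Δ₁ t (.arrow A B) → CtxTyped P m C Δ B →
      CtxTyped P m (.appR t :: C) Δ₂ A
  | bang {C : Ctx S} {Δ : List Hyp} {A : Ty} : P (.bang A) → CtxTyped P m C Δ (.bang A) →
      CtxTyped P m (.bang :: C) (Δ.map Hyp.dropAffine) A
  | letArg {C : Ctx S} {Δ Δ₁ Δ₂ : List Hyp} {t : Term S} {A B : Ty} : P B → Split Δ Δ₁ Δ₂ →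
      HasTypeIn P m (.unr A :: Δ₂) t B → CtxTyped P m C Δ B →
      CtxTyped P m (.letArg t :: C) Δ₁ (.bang A)
  | letBody {C : Ctx S} {Δ Δ₁ Δ₂ : List Hyp} {u : Term S} {A B : Ty} : P B → Split Δ Δ₁ Δ₂ →
      HasTypeIn P m Δ₁ u (.bang A) → CtxTyped P m C Δ B →
      CtxTyped P m (.letBody u :: C) (.unr A :: Δ₂) B

section
variable {P : Ty → Prop} {m : Ty}

/-- Going outwards, each frame is typed around the term built so far, until the frame that
introduced the hypothesis. This is a `λ`, and no box is crossed on the way, since a box hides affine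
hypotheses. -/
theorem CtxTyped.binder_aff {C : Ctx S} {Δ : List Hyp} {B : Ty} (h : CtxTyped P m C Δ B) :
    ∀ (n : ℕ) (A : Ty) (t : Term S), Δ[n]? = some (.aff A) → HasTypeIn P m Δ t B →
      ∃ D C' Δ' B', Ctx.binder n C = some (D, .lam, C') ∧ CtxTyped P m C' Δ' (.arrow A B') ∧
        HasTypeIn P m Δ' (.lam (Ctx.plug D t)) (.arrow A B') := by
  induction h with
  | nil => intro n A t h; simp at h
  | @lam C Δ A' B hAB hC ih =>
    intro n A t h ht
    cases n with
    | zero =>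
      obtain rfl : A' = A := by simpa using h
      exact ⟨_, _, _, _, rfl, hC, .lam hAB ht⟩
    | succ n =>
      obtain ⟨D, C', Δ', B', h1, h2, h3⟩ := ih n A _ (by simpa using h) (.lam hAB ht)
      exact ⟨_, C', Δ', B', by simp [Ctx.binder, Frame.binds, h1]; rfl, h2, h3⟩
  | @appL C Δ Δ₁ Δ₂ u A' B hB hs hu hC ih =>
    intro n A t h ht
    obtain ⟨D, C', Δ', B', h1, h2, h3⟩ := ih n A _ (by have := hs.get n; simp_all)
      (.app hB hs ht hu)
    exact ⟨_, C', Δ', B', by simp [Ctx.binder, Frame.binds, h1]; rfl, h2, h3⟩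
  | @appR C Δ Δ₁ Δ₂ r A' B hB hs hr hC ih =>
    intro n A t h ht
    obtain ⟨D, C', Δ', B', h1, h2, h3⟩ := ih n A _ (by have := hs.get n; simp_all)
      (.app hB hs hr ht)
    exact ⟨_, C', Δ', B', by simp [Ctx.binder, Frame.binds, h1]; rfl, h2, h3⟩
  | bang hA hC ih =>
    intro n A t h ht
    simp [Hyp.dropAffine_ne_aff] at h
  | @letArg C Δ Δ₁ Δ₂ r A' B hB hs hr hC ih =>
    intro n A t h ht
    obtain ⟨D, C', Δ', B', h1, h2, h3⟩ := ih n A _ (by have := hs.get n; simp_all)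
      (.letb hB hs ht hr)
    exact ⟨_, C', Δ', B', by simp [Ctx.binder, Frame.binds, h1]; rfl, h2, h3⟩
  | @letBody C Δ Δ₁ Δ₂ u A' B hB hs hu hC ih =>
    intro n A t h ht
    cases n with
    | zero => simp at h
    | succ n =>
      obtain ⟨D, C', Δ', B', h1, h2, h3⟩ := ih n A _ (by have := hs.get n; simp_all)
        (.letb hB hs hu ht)
      exact ⟨_, C', Δ', B', by simp [Ctx.binder, Frame.binds, h1]; rfl, h2, h3⟩

/-- The same walk as for affine variables, except that boxes may be crossed and it ends at a `let`.
The conclusion types the configuration to which the token jumps. -/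
theorem CtxTyped.binder_unr {C : Ctx S} {Δ : List Hyp} {B : Ty} (h : CtxTyped P m C Δ B) :
    ∀ (n : ℕ) (A : Ty) (t : Term S), Δ[n]? = some (.unr A) → HasTypeIn P m Δ t B →
      ∃ D u C' Δ', Ctx.binder n C = some (D, .letBody u, C') ∧
        CtxTyped P m (.letArg (Ctx.plug D t) :: C') Δ' (.bang A) ∧
        HasTypeIn P m Δ' u (.bang A) := by
  induction h with
  | nil => intro n A t h; simp at h
  | @lam C Δ A' B hAB hC ih =>
    intro n A t h ht
    cases n with
    | zero => simp at h
    | succ n =>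
      obtain ⟨D, u', C', Δ', h1, h2, h3⟩ := ih n A _ (by simpa using h) (.lam hAB ht)
      exact ⟨_, u', C', Δ', by simp [Ctx.binder, Frame.binds, h1]; rfl, h2, h3⟩
  | @appL C Δ Δ₁ Δ₂ u A' B hB hs hu hC ih =>
    intro n A t h ht
    obtain ⟨D, u', C', Δ', h1, h2, h3⟩ := ih n A _ (by have := hs.get n; simp_all)
      (.app hB hs ht hu)
    exact ⟨_, u', C', Δ', by simp [Ctx.binder, Frame.binds, h1]; rfl, h2, h3⟩
  | @appR C Δ Δ₁ Δ₂ r A' B hB hs hr hC ih =>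
    intro n A t h ht
    obtain ⟨D, u', C', Δ', h1, h2, h3⟩ := ih n A _ (by have := hs.get n; simp_all)
      (.app hB hs hr ht)
    exact ⟨_, u', C', Δ', by simp [Ctx.binder, Frame.binds, h1]; rfl, h2, h3⟩
  | @bang C Δ A' hA hC ih =>
    intro n A t h ht
    obtain ⟨D, u', C', Δ', h1, h2, h3⟩ := ih n A _
      (by simpa [Hyp.dropAffine_eq_unr] using h) (.bang hA ht)
    exact ⟨_, u', C', Δ', by simp [Ctx.binder, Frame.binds, h1]; rfl, h2, h3⟩
  | @letArg C Δ Δ₁ Δ₂ r A' B hB hs hr hC ih =>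
    intro n A t h ht
    obtain ⟨D, u', C', Δ', h1, h2, h3⟩ := ih n A _ (by have := hs.get n; simp_all)
      (.letb hB hs ht hr)
    exact ⟨_, u', C', Δ', by simp [Ctx.binder, Frame.binds, h1]; rfl, h2, h3⟩
  | @letBody C Δ Δ₁ Δ₂ u A' B hB hs hu hC ih =>
    intro n A t h ht
    cases n with
    | zero =>
      obtain rfl : A' = A := by simpa using h
      exact ⟨_, _, _, _, rfl, .letArg hB hs ht hC, hu⟩
    | succ n =>
      obtain ⟨D, u', C', Δ', h1, h2, h3⟩ := ih n A _ (by have := hs.get n; simp_all)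
        (.letb hB hs hu ht)
      exact ⟨_, u', C', Δ', by simp [Ctx.binder, Frame.binds, h1]; rfl, h2, h3⟩

/-- The occurrence of an affine variable is typed. -/
theorem HasTypeIn.occ_aff {Δ : List Hyp} {t : Term S} {B : Ty} (h : HasTypeIn P m Δ t B) :
    ∀ (n : ℕ) (A : Ty) (C D : Ctx S) (k : ℕ), Δ[n]? = some (.aff A) → CtxTyped P m C Δ B →
      t.occ n = some (D, k) → ∃ Δ', CtxTyped P m (D ++ C) Δ' A ∧ Δ'[k]? = some (.aff A) := by
  induction h with
  | const | mark => intro n A C D k _ _ h; simp [Term.occ] at h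
  | affVar _ h | unrVar _ h =>
    intro n A C D k hn hC ho
    simp only [Term.occ] at ho
    split_ifs at ho with hh
    subst hh
    rw [h] at hn
    simp only [Option.some.injEq, Prod.mk.injEq] at ho
    obtain ⟨rfl, rfl⟩ := ho
    cases hn <;> exact ⟨_, hC, h⟩
  | @lam Δ t A' B hAB ht ih =>
    intro n A C D k hn hC ho
    simp only [Term.occ, Option.map_eq_some_iff] at ho
    obtain ⟨⟨D', k'⟩, h1, h2⟩ := ho
    simp only [Prod.mk.injEq] at h2
    obtain ⟨rfl, rfl⟩ := h2
    simpa using ih (n + 1) A _ _ _ (by simpa using hn) (.lam hAB hC) h1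
  | @app Δ Δ₁ Δ₂ t u A' B hB hs ht hu iht ihu =>
    intro n A C D k hn hC ho
    have hg := hs.get n
    simp [hn] at hg
    rcases hg with hg | hg
    · simp only [Term.occ, hu.occ_eq_none n hg.2, Option.map_none, Option.or_none,
        Option.orElse_eq_orElse, Option.orElse_eq_or, Option.map_eq_some_iff] at ho
      obtain ⟨⟨D', k'⟩, h1, h2⟩ := ho
      simp only [Prod.mk.injEq] at h2
      obtain ⟨rfl, rfl⟩ := h2
      simpa using iht n A _ _ _ hg.1 (.appL hB hs hu hC) h1
    · simp only [Term.occ, ht.occ_eq_none n hg.1, Option.map_none, Option.none_or,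
        Option.orElse_eq_orElse, Option.orElse_eq_or, Option.map_eq_some_iff] at ho
      obtain ⟨⟨D', k'⟩, h1, h2⟩ := ho
      simp only [Prod.mk.injEq] at h2
      obtain ⟨rfl, rfl⟩ := h2
      simpa using ihu n A _ _ _ hg.2 (.appR hB hs ht hC) h1
  | @bang Δ t A' hA ht ih =>
    intro n A C D k hn hC ho
    simp [Term.occ, ht.occ_eq_none n (by simp [hn, Hyp.dropAffine])] at ho
  | @letb Δ Δ₁ Δ₂ u t A' B hB hs hu ht ihu iht =>
    intro n A C D k hn hC ho
    have hg := hs.get n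
    simp [hn] at hg
    rcases hg with hg | hg
    · simp only [Term.occ, ht.occ_eq_none (n + 1) (by simpa using hg.2), Option.map_none,
        Option.or_none, Option.orElse_eq_orElse, Option.orElse_eq_or,
        Option.map_eq_some_iff] at ho
      obtain ⟨⟨D', k'⟩, h1, h2⟩ := ho
      simp only [Prod.mk.injEq] at h2
      obtain ⟨rfl, rfl⟩ := h2
      simpa using ihu n A _ _ _ hg.1 (.letArg hB hs ht hC) h1
    · simp only [Term.occ, hu.occ_eq_none n hg.1, Option.map_none, Option.none_or,
        Option.orElse_eq_orElse, Option.orElse_eq_or, Option.map_eq_some_iff] at ho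
      obtain ⟨⟨D', k'⟩, h1, h2⟩ := ho
      simp only [Prod.mk.injEq] at h2
      obtain ⟨rfl, rfl⟩ := h2
      simpa using iht (n + 1) A _ _ _ (by simpa using hg.2) (.letBody hB hs hu hC) h1

end

/-! The tape is the address of an atom in the type of the focus -/

def Polarity.flip : Polarity → Polarity
  | down => up
  | up => down

/-- `T` is the address in `A` of an occurrence of `o` or `!o`, positive if and only if `d` is
`↓`. -/
def Ty.Addresses : Ty → Polarity → Tape → Prop
  | o, d, T => d = .down ∧ T = []
  | bang A, d, T => A = o ∧ d = .down ∧ T = []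
  | arrow _ _, _, [] => False
  | arrow _ B, d, .p :: T => B.Addresses d T
  | arrow A _, d, .c :: T => A.Addresses d.flip T

def Ty.height : Ty → ℕ
  | o => 0
  | arrow A B => max A.height B.height + 1
  | bang A => A.height + 1

theorem Ty.Addresses.length_le {A : Ty} : ∀ {d : Polarity} {T : Tape}, A.Addresses d T →
    T.length ≤ A.height := by
  induction A with
  | o => rintro d T ⟨_, rfl⟩; simp
  | bang A => rintro d T ⟨_, _, rfl⟩; simp
  | arrow A B ihA ihB =>
    intro d T h
    match T with
    | [] => exact h.elim
    | .p :: T => have := ihB (show B.Addresses d T from h); simp [Ty.height]; omega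
    | .c :: T => have := ihA (show A.Addresses d.flip T from h); simp [Ty.height]; omega

theorem Ty.addresses_arrows_o_down : ∀ {k : ℕ} {T : Tape},
    (Ty.arrows .o k .o).Addresses .down T → T = List.replicate k Sym.p := by
  intro k
  induction k with
  | zero => rintro T ⟨_, rfl⟩; rfl
  | succ k ih =>
    intro T h
    match T with
    | [] => exact h.elim
    | .p :: T => rw [ih (T := T) h]; rfl
    -- The argument `o` occurs negatively, so a downward address cannot lead into it.
    | .c :: T => cases (show Polarity.flip .down = .down ∧ T = [] from h).1

theorem Ty.addresses_arrows_o_up : ∀ {k i : ℕ}, i < k →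
    (Ty.arrows .o k .o).Addresses .up (List.replicate i Sym.p ++ [.c]) := by
  intro k
  induction k with
  | zero => intro i h; omega
  | succ k ih =>
    intro i h
    cases i with
    | zero => exact ⟨rfl, rfl⟩
    | succ i => exact ih (i := i) (by omega)

/-- The configuration is well-typed. -/
def RawConfig.Typed (P : Ty → Prop) (m : Ty) (c : RawConfig S) : Prop :=
  ∃ Δ A, CtxTyped P m c.ctx Δ A ∧ HasTypeIn P m Δ c.focus A ∧ A.Addresses c.dir c.tape

/-- Each step moves to a focus whose type contains the same atom, or is contained in the old type
around it, and the tape changes accordingly. Polarity flips exactly when the token enters or leaves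
the left of an arrow. Constants are the exception: they pass from the result `o` to the argument
atoms. -/
theorem RawConfig.Typed.of_step {P : Ty → Prop} {m : Ty} (hP : SubformulaClosed P)
    (hb : ∀ A, P (.bang A) → A = .o) {c c' : RawConfig S} {s : Tree S (RawConfig S)}
    (hc : c.Typed P m) (hs : rawStep c = some s) (hc' : c' ∈ s.leaves) : c'.Typed P m := by
  obtain ⟨d, r, C, T⟩ := c
  obtain ⟨Δ, A, hC, hr, hA⟩ := hc
  simp only at hC hr hA
  cases d with
  | down =>
    cases hr with
    | const _ c hPc =>
      -- The tape is exactly `pᵏ`: nothing remains below it, and the new tapes `pⁱ∘` address the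
      -- arguments.
      obtain rfl := Ty.addresses_arrows_o_down hA
      simp [rawStep, downStep] at hs
      subst hs
      obtain ⟨i, hi⟩ := Tree.mem_leaves_node.1 hc'
      simp only [Tree.leaves, List.mem_singleton] at hi
      subst hi
      exact ⟨Δ, _, hC, .const _ _ hPc, Ty.addresses_arrows_o_up i.2⟩
    | mark _ i => simp [rawStep, downStep] at hs
    | affVar hPA hn =>
      obtain ⟨D, C', Δ', B', h1, h2, h3⟩ := hC.binder_aff _ _ _ hn (.affVar hPA hn)
      simp only [rawStep, downStep, h1, Option.some.injEq] at hs
      subst hs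
      simp only [Tree.leaves, List.mem_singleton] at hc'
      subst hc'
      exact ⟨Δ', _, h2, h3, hA⟩
    | unrVar hPA hn =>
      obtain ⟨D, u, C', Δ', h1, h2, h3⟩ := hC.binder_unr _ _ _ hn (.unrVar hPA hn)
      simp only [rawStep, downStep, h1, Option.some.injEq] at hs
      subst hs
      simp only [Tree.leaves, List.mem_singleton] at hc'
      subst hc'
      -- The variable has type `o` and the argument of the `let` has type `!o`; the empty tape
      -- addresses both.
      obtain rfl := hb _ h3.prop
      exact ⟨Δ', _, h2, h3, rfl, hA⟩
    | @lam _ t A B hAB ht =>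
      match T with
      | [] => simp [rawStep, downStep] at hs
      | .p :: T =>
        obtain rfl := Option.some.inj hs
        simp only [Tree.leaves, List.mem_singleton] at hc'
        subst hc'
        exact ⟨_, B, .lam hAB hC, ht, hA⟩
      | .c :: T =>
        simp only [rawStep, downStep, Option.map_eq_some_iff] at hs
        obtain ⟨⟨D, k⟩, hr, rfl⟩ := hs
        simp only [Tree.leaves, List.mem_singleton] at hc'
        subst hc'
        obtain ⟨Δ', h1, h2⟩ := ht.occ_aff 0 A _ _ _ (by simp) (.lam hAB hC) hr
        exact ⟨Δ', A, h1, .affVar (hP.arrow hAB).1 h2, hA⟩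
    | app hB hsp ht hu =>
      obtain rfl := Option.some.inj hs
      simp only [Tree.leaves, List.mem_singleton] at hc'
      subst hc'
      exact ⟨_, _, .appL hB hsp hu hC, ht, hA⟩
    | bang hA' ht =>
      obtain rfl := Option.some.inj hs
      simp only [Tree.leaves, List.mem_singleton] at hc'
      subst hc'
      obtain rfl := hA.1
      exact ⟨_, _, .bang hA' hC, ht, hA.2⟩
    | letb hB hsp hu ht =>
      obtain rfl := Option.some.inj hs
      simp only [Tree.leaves, List.mem_singleton] at hc'
      subst hc'
      exact ⟨_, _, .letBody hB hsp hu hC, ht, hA⟩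
  | up =>
    cases hC with
    | nil => simp [rawStep, upStep] at hs
    | lam hAB hC =>
      obtain rfl := Option.some.inj hs
      simp only [Tree.leaves, List.mem_singleton] at hc'
      subst hc'
      exact ⟨_, _, hC, .lam hAB hr, hA⟩
    | appL hB hsp hu hC =>
      match T with
      | [] => simp [rawStep, upStep] at hs
      | .p :: T =>
        obtain rfl := Option.some.inj hs
        simp only [Tree.leaves, List.mem_singleton] at hc'
        subst hc'
        exact ⟨_, _, hC, .app hB hsp hr hu, hA⟩
      | .c :: T =>
        obtain rfl := Option.some.inj hs
        simp only [Tree.leaves, List.mem_singleton] at hc'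
        subst hc'
        exact ⟨_, _, .appR hB hsp hr hC, hu, hA⟩
    | appR hB hsp ht hC =>
      obtain rfl := Option.some.inj hs
      simp only [Tree.leaves, List.mem_singleton] at hc'
      subst hc'
      exact ⟨_, _, .appL hB hsp hr hC, ht, hA⟩
    | bang => simp [rawStep, upStep] at hs
    | letArg => simp [rawStep, upStep] at hs
    | letBody hB hsp hu hC =>
      obtain rfl := Option.some.inj hs
      simp only [Tree.leaves, List.mem_singleton] at hc'
      subst hc'
      exact ⟨_, _, hC, .letb hB hsp hu hr, hA⟩

theorem typed_of_reachable {P : Ty → Prop} {m : Ty} (hP : SubformulaClosed P)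
    (hb : ∀ A, P (.bang A) → A = .o) {v : Term S} (hv : HasTypeIn P m [] v .o)
    {κ : IAMConfig v} (hκ : (apaiam v).Reachable κ) : κ.raw.Typed P m := by
  induction hκ with
  | refl => exact ⟨_, _, .nil, hv, rfl, rfl⟩
  | @tail κ κ' _ hs ih =>
    obtain ⟨t, ht, hκ'⟩ := hs
    have h := iamStep_map_raw κ
    rw [show iamStep v κ = some t from ht] at h
    refine ih.of_step hP hb h.symm ?_
    exact (Tree.leaves_map (IAMConfig.raw (v := v)) t).symm ▸ List.mem_map_of_mem hκ'

/-- The initial configuration is the only reachable one whose focus is the whole term. -/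
theorem RawConfig.Typed.of_ctx_nil {P : Ty → Prop} {m : Ty} {c : RawConfig S}
    (hc : c.Typed P m) (h : c.ctx = []) : c.dir = .down ∧ c.tape = [] := by
  obtain ⟨Δ, A, hC, -, hA⟩ := hc
  rw [h] at hC
  cases hC
  exact hA


/-! Typing the terms of a transducer -/

/-- All types in normal typing derivations of the terms of `L` satisfy `P`. -/
structure LambdaTransducer.Fragment (L : LambdaTransducer Γ S) (P : Ty → Prop) : Prop where
  closed : SubformulaClosed P
  const : ∀ c : S.Letter, P (Ty.arrows .o (S.rk c) .o)
  trans : ∀ a : Γ.Letter, P (Ty.arrows L.memory (Γ.rk a) L.memory)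
  out : P (.arrow L.memory .o)

theorem HasTypeIn.apps {P : Ty → Prop} {m A B : Ty} (hP : SubformulaClosed P)
    (us : List (Term S)) : ∀ t : Term S, HasTypeIn P m [] t (Ty.arrows A us.length B) →
      (∀ u ∈ us, HasTypeIn P m [] u A) → HasTypeIn P m [] (t.apps us) B := by
  induction us with
  | nil => intro t ht _; exact ht
  | cons u us ih =>
    intro t ht hu
    exact ih (.app t u) (.app (hP.arrow ht.prop).2 .nil ht (hu u (by simp)))
      fun v hv => hu v (by simp [hv])

namespace LambdaTransducer.Fragment
variable {L : LambdaTransducer Γ S} {P : Ty → Prop}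

theorem out_typed (hL : L.Fragment P) (hu : L.out.Normal) : HasTypeIn P L.memory [] L.out (.arrow L.memory .o) :=
  (L.out_typed.subformula L.memory hL.closed hL.const hu (by simp)).2.1 hL.out

theorem trans_typed (hL : L.Fragment P) (ht : ∀ a, (L.trans a).Normal) (a : Γ.Letter) :
    HasTypeIn P L.memory [] (L.trans a) (Ty.arrows L.memory (Γ.rk a) L.memory) :=
  ((L.trans_typed a).subformula L.memory hL.closed hL.const (ht a) (by simp)).2.1 (hL.trans a)

theorem marked_typed (hL : L.Fragment P) (ht : ∀ a, (L.trans a).Normal) (a : Γ.Letter) :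
    HasTypeIn P L.memory [] (L.marked a) L.memory := by
  refine .apps hL.closed (A := L.memory) _ _ (by simpa using hL.trans_typed ht a) ?_
  intro u hu
  obtain ⟨i, rfl⟩ := List.mem_ofFn.1 hu
  exact .mark _ _ (hL.closed.arrow hL.out).1

/-- Although `τ̂` is not normal, every type in the derivation comes from a normal `t_a` or is a
suffix of `A^k ⊸ A`, so nothing leaves the fragment. -/
theorem hat_typed (hL : L.Fragment P) (ht : ∀ a, (L.trans a).Normal) (τ : GroundTree Γ) :
    HasTypeIn P L.memory [] (L.hat τ) L.memory := by
  induction τ with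
  | leaf e => exact e.elim
  | node a ts ih =>
    refine .apps hL.closed (A := L.memory) _ _ (by simpa using hL.trans_typed ht a) ?_
    intro u hu
    obtain ⟨i, rfl⟩ := List.mem_ofFn.1 hu
    exact ih i

theorem app_out_typed (hL : L.Fragment P) (hu : L.out.Normal) {t : Term S}
    (ht : HasTypeIn P L.memory [] t L.memory) : HasTypeIn P L.memory [] (.app L.out t) .o :=
  .app (hL.closed.arrow hL.out).2 .nil (hL.out_typed hu) ht

end LambdaTransducer.Fragment

theorem subformulaClosed_purelyAffine : SubformulaClosed Ty.PurelyAffine :=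
  ⟨fun h => h, fun h => h.elim⟩

theorem Ty.PurelyAffine.arrows {A B : Ty} (hA : A.PurelyAffine) (hB : B.PurelyAffine) (k : ℕ) :
    (Ty.arrows A k B).PurelyAffine := by
  induction k with
  | zero => exact hB
  | succ k ih => exact ⟨hA, ih⟩

theorem Ty.AlmostPurelyAffine.arrows {A B : Ty} (hA : A.AlmostPurelyAffine)
    (hB : B.AlmostPurelyAffine) (k : ℕ) : (Ty.arrows A k B).AlmostPurelyAffine := by
  induction k with
  | zero => exact hB
  | succ k ih => exact ⟨hA, ih⟩

theorem LambdaTransducer.fragment_purelyAffine (L : LambdaTransducer Γ S)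
    (hA : L.memory.PurelyAffine) : L.Fragment Ty.PurelyAffine :=
  ⟨subformulaClosed_purelyAffine, fun _ => .arrows (A := .o) (B := .o) trivial trivial _,
    fun _ => hA.arrows hA _, hA, trivial⟩

/-- Almost purely affine types of bounded height. -/
def Ty.AffineBelow (N : ℕ) (A : Ty) : Prop := A.AlmostPurelyAffine ∧ A.height ≤ N

theorem Ty.AffineBelow.eq_o {N : ℕ} {A : Ty} (h : (Ty.bang A).AffineBelow N) : A = .o := h.1

theorem subformulaClosed_affineBelow (N : ℕ) : SubformulaClosed (Ty.AffineBelow N) := by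
  refine ⟨fun {A B} h => ?_, fun {A} h => ?_⟩
  · obtain ⟨⟨hA, hB⟩, h⟩ := h
    simp only [Ty.height] at h
    exact ⟨⟨hA, by omega⟩, hB, by omega⟩
  · obtain ⟨rfl, h⟩ := h
    exact ⟨trivial, by simp [Ty.height]⟩

/-- Both alphabets are finite, so the heights of the types of the constants and of the transition
terms are bounded. -/
theorem LambdaTransducer.exists_fragment_affineBelow (L : LambdaTransducer Γ S)
    (hA : L.memory.AlmostPurelyAffine) : ∃ N, L.Fragment (Ty.AffineBelow N) := by
  have := Γ.finite
  have := S.finite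
  obtain ⟨N₁, h₁⟩ := (Set.finite_range fun c : S.Letter =>
    (Ty.arrows .o (S.rk c) .o).height).bddAbove
  obtain ⟨N₂, h₂⟩ := (Set.finite_range fun a : Γ.Letter =>
    (Ty.arrows L.memory (Γ.rk a) L.memory).height).bddAbove
  refine ⟨max N₁ (max N₂ (Ty.arrow L.memory .o).height), subformulaClosed_affineBelow _,
    fun c => ⟨.arrows (A := .o) (B := .o) trivial trivial _, ?_⟩, fun a => ⟨hA.arrows hA _, ?_⟩,
    ⟨⟨hA, trivial⟩, ?_⟩⟩
  · exact (h₁ ⟨c, rfl⟩).trans (by simp)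
  · exact (h₂ ⟨a, rfl⟩).trans (by simp)
  · simp

/-- The height bound of the fragment depends only on the transducer, hence serves all inputs at
once. -/
theorem LambdaTransducer.exists_tapeBound (L : LambdaTransducer Γ S)
    (hA : L.memory.AlmostPurelyAffine) (hu : L.out.Normal) (ht : ∀ a, (L.trans a).Normal) :
    ∃ H, L.TapeBound H := by
  obtain ⟨N, hL⟩ := L.exists_fragment_affineBelow hA
  refine ⟨N, fun τ κ hκ => ?_⟩
  obtain ⟨Δ, A, hC, hr, hA⟩ := typed_of_reachable hL.closed (fun A h => h.eq_o)
    (hL.app_out_typed hu (hL.hat_typed ht τ)) hκ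
  exact hA.length_le.trans hr.prop.2

/-! Reversibility of the machine on purely affine terms -/

theorem Ctx.depth_append (C D : Ctx S) : Ctx.depth (C ++ D) = Ctx.depth C + Ctx.depth D := by
  induction C with
  | nil => simp [Ctx.depth]
  | cons f C ih => simp [Ctx.depth, ih, Nat.add_assoc]

/-- A de Bruijn index counts the binders between the variable and its own. With `Ctx.binder_append`
and `Term.occ_depth`, this relates the searches upwards and downwards. -/
theorem Ctx.binder_depth (C : Ctx S) : ∀ (n : ℕ) (D : Ctx S) (f : Frame S) (C' : Ctx S),
    Ctx.binder n C = some (D, f, C') → n = Ctx.depth D ∧ f.binds = true := by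
  induction C with
  | nil => intro n D f C' h; simp [Ctx.binder] at h
  | cons g C ih =>
    intro n D f C' h
    unfold Ctx.binder at h
    rcases hb : g.binds with _ | _
    · simp only [hb] at h
      obtain ⟨⟨D', f', C''⟩, h1, h2⟩ := Option.map_eq_some_iff.1 h
      simp only [Prod.mk.injEq] at h2
      obtain ⟨rfl, rfl, rfl⟩ := h2
      simpa [Ctx.depth, hb] using ih _ _ _ _ h1
    · cases n with
      | zero =>
        simp only [hb, Option.some.injEq, Prod.mk.injEq] at h
        obtain ⟨rfl, rfl, rfl⟩ := h
        exact ⟨rfl, hb⟩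
      | succ n =>
        simp only [hb] at h
        obtain ⟨⟨D', f', C''⟩, h1, h2⟩ := Option.map_eq_some_iff.1 h
        simp only [Prod.mk.injEq] at h2
        obtain ⟨rfl, rfl, rfl⟩ := h2
        simpa [Ctx.depth, hb, Nat.add_comm 1] using ih _ _ _ _ h1

theorem Ctx.binder_append (D : Ctx S) (f : Frame S) (C : Ctx S) (hf : f.binds = true) :
    Ctx.binder (Ctx.depth D) (D ++ f :: C) = some (D, f, C) := by
  induction D with
  | nil => simp [Ctx.binder, Ctx.depth, hf]
  | cons g D ih =>
    rw [List.cons_append]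
    unfold Ctx.binder Ctx.depth
    rcases hb : g.binds with _ | _ 
    · simp [ih]
    · simp [Nat.add_comm 1, ih]

theorem Term.occ_depth (t : Term S) : ∀ (n : ℕ) (D : Ctx S) (k : ℕ), t.occ n = some (D, k) →
    k = n + Ctx.depth D := by
  induction t with
  | const c => intro n D k h; simp [Term.occ] at h
  | mark i => intro n D k h; simp [Term.occ] at h
  | var m =>
    intro n D k h
    simp only [Term.occ] at h
    split_ifs at h with hh
    simp only [Option.some.injEq, Prod.mk.injEq] at h
    obtain ⟨rfl, rfl⟩ := h
    exact hh
  | lam t ih =>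
    intro n D k h
    simp [Term.occ] at h
    obtain ⟨D', h1, rfl⟩ := h
    simp [Ctx.depth_append, Ctx.depth, Frame.binds, ih _ _ _ h1]
    omega
  | bang t ih =>
    intro n D k h
    simp [Term.occ] at h
    obtain ⟨D', h1, rfl⟩ := h
    simp [Ctx.depth_append, Ctx.depth, Frame.binds, ih _ _ _ h1]
  | app t u iht ihu =>
    intro n D k h
    simp [Term.occ] at h
    rcases h with ⟨D', h1, rfl⟩ | ⟨_, D', h1, rfl⟩
    · simp [Ctx.depth_append, Ctx.depth, Frame.binds, iht _ _ _ h1]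
    · simp [Ctx.depth_append, Ctx.depth, Frame.binds, ihu _ _ _ h1]
  | letb u t ihu iht =>
    intro n D k h
    simp [Term.occ] at h
    rcases h with ⟨D', h1, rfl⟩ | ⟨_, D', h1, rfl⟩
    · simp [Ctx.depth_append, Ctx.depth, Frame.binds, ihu _ _ _ h1]
    · simp [Ctx.depth_append, Ctx.depth, Frame.binds, iht _ _ _ h1]
      omega


/-- Without typing, the leftmost search may return another occurrence, so only its success is
claimed. Success on the side of a split where the variable is absent is a contradiction. -/
theorem Term.occ_plug_ne_none (D : Ctx S) : ∀ {n k : ℕ}, k = n + Ctx.depth D →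
    (Ctx.plug D (.var k)).occ n ≠ none := by
  induction D using List.reverseRecOn with
  | nil => rintro n k rfl; simp [Ctx.plug, Term.occ]
  | append_singleton D f ih =>
    intro n k hk
    rw [Ctx.depth_append] at hk
    rw [Ctx.plug_append]
    have h0 := @ih n k
    have h1 := @ih (n + 1) k
    cases f <;> simp_all [Ctx.plug, Frame.plug, Ctx.depth, Frame.binds, Term.occ, Nat.add_assoc,
      Nat.add_comm]

/-- An affine variable has at most one occurrence. -/
theorem HasTypeIn.occ_plug {P : Ty → Prop} {m : Ty} (D : Ctx S) : ∀ {Δ : List Hyp} {B : Ty}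
    {n k : ℕ} {A : Ty}, k = n + Ctx.depth D → HasTypeIn P m Δ (Ctx.plug D (.var k)) B →
      Δ[n]? = some (.aff A) → (Ctx.plug D (.var k)).occ n = some (D, k) := by
  induction D using List.reverseRecOn with
  | nil => rintro Δ B n k A rfl _ _; simp [Ctx.plug, Term.occ]
  | append_singleton D f ih =>
    intro Δ B n k A hk h hn
    rw [Ctx.depth_append] at hk
    rw [Ctx.plug_append] at h ⊢
    cases f with
    | lam =>
      replace hk : k = n + 1 + Ctx.depth D := by
        simp [Ctx.depth, Frame.binds] at hk; omega
      cases h with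
      | lam hAB h => simp [Ctx.plug, Frame.plug, Term.occ, ih hk h (by simpa using hn)]
    | appL u =>
      replace hk : k = n + Ctx.depth D := by simpa [Ctx.depth, Frame.binds] using hk
      cases h with
      | app hB hs ht hu =>
        have hg := hs.get n
        simp [hn] at hg
        rcases hg with hg | hg
        · simp [Ctx.plug, Frame.plug, Term.occ, ih hk ht hg.1]
        · exact absurd (ht.occ_eq_none n hg.1) (Term.occ_plug_ne_none D hk)
    | appR t =>
      replace hk : k = n + Ctx.depth D := by simpa [Ctx.depth, Frame.binds] using hk
      cases h with
      | app hB hs ht hu =>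
        have hg := hs.get n
        simp [hn] at hg
        rcases hg with hg | hg
        · exact absurd (hu.occ_eq_none n hg.2) (Term.occ_plug_ne_none D hk)
        · simp [Ctx.plug, Frame.plug, Term.occ, ht.occ_eq_none n hg.1, ih hk hu hg.2]
    | bang =>
      replace hk : k = n + Ctx.depth D := by simpa [Ctx.depth, Frame.binds] using hk
      cases h with
      | bang hA h =>
        exact absurd (h.occ_eq_none n (by simp [hn, Hyp.dropAffine]))
          (Term.occ_plug_ne_none D hk)
    | letArg t =>
      replace hk : k = n + Ctx.depth D := by simpa [Ctx.depth, Frame.binds] using hk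
      cases h with
      | letb hB hs hu ht =>
        have hg := hs.get n
        simp [hn] at hg
        rcases hg with hg | hg
        · simp [Ctx.plug, Frame.plug, Term.occ, ih hk hu hg.1]
        · exact absurd (hu.occ_eq_none n hg.1) (Term.occ_plug_ne_none D hk)
    | letBody u =>
      replace hk : k = n + 1 + Ctx.depth D := by
        simp [Ctx.depth, Frame.binds] at hk; omega
      cases h with
      | letb hB hs hu ht =>
        have hg := hs.get n
        simp [hn] at hg
        rcases hg with hg | hg
        · exact absurd (ht.occ_eq_none (n + 1) (by simpa using hg.2))
            (Term.occ_plug_ne_none D hk)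
        · simp [Ctx.plug, Frame.plug, Term.occ, hu.occ_eq_none n hg.1,
            ih hk ht (by simpa using hg.2)]

/-- The configuration that precedes a configuration, in a run on a purely affine term. -/
def rawPred : RawConfig S → Option (RawConfig S)
  | ⟨.down, t, .appL u :: C, .p :: T⟩ => some ⟨.down, .app t u, C, T⟩
  | ⟨.down, t, .appL u :: C, .c :: T⟩ => some ⟨.up, u, .appR t :: C, T⟩
  | ⟨.down, u, .appR t :: C, T⟩ => some ⟨.up, t, .appL u :: C, .c :: T⟩
  | ⟨.down, t, .lam :: C, T⟩ => some ⟨.down, .lam t, C, .p :: T⟩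
  | ⟨.up, .app t u, C, T⟩ => some ⟨.up, t, .appL u :: C, .p :: T⟩
  | ⟨.up, .lam t, C, .p :: T⟩ => some ⟨.up, t, .lam :: C, T⟩
  | ⟨.up, .lam t, C, .c :: T⟩ =>
    (t.occ 0).map fun r => ⟨.down, .var r.2, r.1 ++ .lam :: C, T⟩
  | ⟨.up, .var n, C, T⟩ =>
    (Ctx.binder n C).map fun r => ⟨.down, .lam (Ctx.plug r.1 (.var n)), r.2.2, .c :: T⟩
  -- The tape is `pⁱ∘T'` with `i` unknown: removing the run of `p` and the `∘` recovers `T'`, the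
  -- same for every `i`.
  | ⟨.up, .const c, C, T⟩ =>
    some ⟨.down, .const c, C,
      List.replicate (S.rk c) Sym.p ++ (T.dropWhile fun s => s = Sym.p).tail⟩
  | _ => none

theorem dropWhile_replicate_p (i : ℕ) (T : Tape) :
    (List.replicate i Sym.p ++ Sym.c :: T).dropWhile (fun s => s = Sym.p) = Sym.c :: T := by
  induction i with
  | zero => simp
  | succ i ih => simp [List.replicate_succ, ih]

/-- Without `let` and boxes, the rule that produced a configuration can be read off its direction,
focus, innermost frame and top tape symbol. For variable steps, typing ensures that the occurrence
found under the `λ` is the one the token came from. -/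
theorem rawPred_of_mem {P : Ty → Prop} {m A : Ty} (hP : ∀ A, ¬ P (.bang A))
    {c c' : RawConfig S} {s : Tree S (RawConfig S)} (hc : HasTypeIn P m [] c.term A)
    (hs : rawStep c = some s) (hc' : c' ∈ s.leaves) : rawPred c' = some c := by
  obtain ⟨d, r, C, T⟩ := c
  cases d with
  | down =>
    obtain ⟨Δ, B, hr⟩ := HasTypeIn.of_plug C hc
    cases hr with
    | const _ c hPc =>
      simp only [rawStep, downStep] at hs
      split_ifs at hs with hT
      obtain rfl := Option.some.inj hs
      obtain ⟨i, hi⟩ := Tree.mem_leaves_node.1 hc'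
      simp only [Tree.leaves, List.mem_singleton] at hi
      subst hi
      simp only [rawPred, dropWhile_replicate_p, List.tail_cons, ← hT, List.take_append_drop]
    | mark _ i => simp [rawStep, downStep] at hs
    | affVar _ _ | unrVar _ _ =>
      rename_i n _ _
      simp only [rawStep, downStep] at hs
      split at hs
      · rename_i D C' hb
        obtain rfl := Option.some.inj hs
        simp only [Tree.leaves, List.mem_singleton] at hc'
        subst hc'
        obtain ⟨rfl, -⟩ := Ctx.binder_depth _ _ _ _ _ hb
        obtain rfl := Ctx.binder_eq _ _ _ _ _ hb
        rw [RawConfig.term, Ctx.plug_append] at hc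
        obtain ⟨Δ', B', h'⟩ := HasTypeIn.of_plug C' hc
        cases h' with
        | lam hAB ht =>
          -- Affinity is used here: a duplicated variable would make the step to its `λ`
          -- non-injective.
          have := HasTypeIn.occ_plug D (n := 0) (Nat.zero_add _).symm ht rfl
          simp [rawPred, this]
      · rename_i D u C' hb
        obtain rfl := Ctx.binder_eq _ _ _ _ _ hb
        rw [RawConfig.term, Ctx.plug_append] at hc
        obtain ⟨Δ', B', h'⟩ := HasTypeIn.of_plug C' hc
        cases h' with
        | letb _ _ hu _ => exact absurd hu.prop (hP _)
      · simp at hs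
    | @lam _ t A B hAB ht =>
      match T with
      | [] => simp [rawStep, downStep] at hs
      | .p :: T =>
        obtain rfl := Option.some.inj hs
        simp only [Tree.leaves, List.mem_singleton] at hc'
        subst hc'
        rfl
      | .c :: T =>
        simp only [rawStep, downStep, Option.map_eq_some_iff] at hs
        obtain ⟨⟨D, k⟩, hr, rfl⟩ := hs
        simp only [Tree.leaves, List.mem_singleton] at hc'
        subst hc'
        obtain rfl := Term.occ_depth _ _ _ _ hr
        have h1 := Term.plug_occ _ _ _ _ hr
        simp only [Nat.zero_add] at h1 ⊢
        simp [rawPred, Ctx.binder_append D .lam C rfl, h1]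
    | app hB hsp ht hu =>
      obtain rfl := Option.some.inj hs
      simp only [Tree.leaves, List.mem_singleton] at hc'
      subst hc'
      rfl
    | bang hA' ht => exact absurd hA' (hP _)
    | letb hB hsp hu ht => exact absurd hu.prop (hP _)
  | up =>
    match C, T with
    | [], _ | .appL u :: C, [] | .bang :: C, T | .letArg _ :: C, T => simp [rawStep, upStep] at hs
    | .appL u :: C, .p :: T | .appL u :: C, .c :: T | .appR r :: C, T | .lam :: C, T =>
      obtain rfl := Option.some.inj hs
      simp only [Tree.leaves, List.mem_singleton] at hc'
      subst hc'
      rfl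
    | .letBody u :: C, T =>
      obtain ⟨Δ', B', h'⟩ := HasTypeIn.of_plug C hc
      cases h' with
      | letb _ _ hu _ => exact absurd hu.prop (hP _)

theorem rawStep_leaves_nodup {c : RawConfig S} {s : Tree S (RawConfig S)}
    (hs : rawStep c = some s) : s.leaves.Nodup := by
  obtain ⟨d, r, C, T⟩ := c
  cases d with
  | down =>
    cases r with
    | const c =>
      simp only [rawStep, downStep] at hs
      split_ifs at hs
      obtain rfl := Option.some.inj hs
      have : ∀ {n : ℕ} (g : Fin n → RawConfig S),
          (List.ofFn fun i => [g i]).flatten = List.ofFn g := by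
        intro n g
        induction n with
        | zero => rfl
        | succ n ih => simp [List.ofFn_succ, ih]
      simp only [Tree.leaves, this]
      refine List.nodup_ofFn.2 fun i j hij => ?_
      simp only [RawConfig.mk.injEq, true_and] at hij
      -- The number of leading `p` is the index of the argument, so the leaves are distinct.
      have h := congrArg (fun l : Tape => (l.takeWhile fun s => s = Sym.p).length) hij
      have key : ∀ (i : ℕ) (T : Tape),
          ((List.replicate i Sym.p ++ Sym.c :: T).takeWhile fun s => s = Sym.p).length = i := by
        intro i T
        induction i with
        | zero => simp
        | succ i ih => simp [List.replicate_succ]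
      simp only [key] at h
      exact Fin.ext h
    | mark i => simp [rawStep, downStep] at hs
    | var n =>
      simp only [rawStep, downStep] at hs
      split at hs <;> simp at hs <;> subst hs <;> simp [Tree.leaves]
    | lam t =>
      match T with
      | [] => simp [rawStep, downStep] at hs
      | .p :: T => obtain rfl := Option.some.inj hs; simp [Tree.leaves]
      | .c :: T =>
        simp only [rawStep, downStep, Option.map_eq_some_iff] at hs
        obtain ⟨r, hr, rfl⟩ := hs
        simp [Tree.leaves]
    | app t u | bang t | letb u t => obtain rfl := Option.some.inj hs; simp [Tree.leaves]
  | up =>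
    match C, T with
    | [], _ | .appL u :: C, [] | .bang :: C, T | .letArg _ :: C, T => simp [rawStep, upStep] at hs
    | .appL u :: C, .p :: T | .appL u :: C, .c :: T | .appR r :: C, T | .lam :: C, T
    | .letBody u :: C, T => obtain rfl := Option.some.inj hs; simp [Tree.leaves]


/-! Positions in `t u₁ ⋯ uₖ` -/

namespace Term

theorem apps_append (t : Term S) (us vs : List (Term S)) :
    t.apps (us ++ vs) = (t.apps us).apps vs := List.foldl_append

theorem sub_apps (σ : ℕ → Term S) (us : List (Term S)) : ∀ t : Term S,
    (t.apps us).sub σ = (t.sub σ).apps (us.map (Term.sub σ)) := by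
  induction us with
  | nil => intro t; rfl
  | cons u us ih => intro t; exact ih (.app t u)

theorem eq_mark_of_apps {i : ℕ} (us : List (Term S)) : ∀ t : Term S, t.apps us = .mark i →
    t = .mark i := by
  induction us with
  | nil => intro t h; exact h
  | cons u us ih => intro t h; exact absurd (ih (.app t u) h) (by simp)

/-- The context of the `i`-th argument (numbered from `0`) in `t u₁ ⋯ uₖ`. -/
def argCtx (t : Term S) (us : List (Term S)) (i : ℕ) : Ctx S :=
  .appR (t.apps (us.take i)) :: (us.drop (i + 1)).map .appL

theorem argCtx_sub (σ : ℕ → Term S) (t : Term S) (us : List (Term S)) (i : ℕ) :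
    Ctx.sub σ (t.argCtx us i) = (t.sub σ).argCtx (us.map (Term.sub σ)) i := by
  simp [argCtx, Ctx.sub, Frame.sub, sub_apps, List.map_take, List.map_drop]
  rfl

theorem plug_map_appL (us : List (Term S)) : ∀ t : Term S,
    Ctx.plug (us.map .appL) t = t.apps us := by
  induction us with
  | nil => intro t; rfl
  | cons u us ih => intro t; exact ih (.app t u)

theorem plug_argCtx (t : Term S) (us : List (Term S)) (i : ℕ) (h : i < us.length) :
    Ctx.plug (t.argCtx us i) us[i] = t.apps us := by
  have h1 : Ctx.plug (t.argCtx us i) us[i] = (t.apps (us.take i ++ [us[i]])).apps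
      (us.drop (i + 1)) := by
    rw [apps_append]
    exact plug_map_appL _ _
  rw [h1, ← apps_append, List.append_assoc]
  simp

/-- A position is inside the head, inside an argument, or on the application spine. The cases
overlap harmlessly at the root of the head. -/
theorem plug_eq_apps {C : Ctx S} {r : Term S} (us : List (Term S)) : ∀ t : Term S,
    Ctx.plug C r = t.apps us →
      (∃ D, C = D ++ us.map .appL ∧ Ctx.plug D r = t) ∨
      (∃ i, ∃ h : i < us.length, ∃ D, C = D ++ t.argCtx us i ∧ Ctx.plug D r = us[i]) ∨
      (∃ j, C = (us.drop j).map .appL ∧ r = t.apps (us.take j)) := by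
  induction us with
  | nil => intro t h; exact .inl ⟨C, by simp, h⟩
  | cons u us ih =>
    intro t h
    rcases ih (.app t u) h with ⟨D, rfl, hD⟩ | ⟨i, hi, D, rfl, hD⟩ | ⟨j, rfl, rfl⟩
    · rcases D.eq_nil_or_concat with rfl | ⟨D', f, rfl⟩
      -- An empty context in the enlarged head `t u` is a spine position with one argument applied.
      · exact .inr (.inr ⟨1, by simp, hD⟩)
      · rw [List.concat_eq_append, Ctx.plug_append] at hD
        cases f with
        | appL v =>
          obtain ⟨h1, rfl⟩ := Term.app.inj hD
          exact .inl ⟨D', by simp, h1⟩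
        | appR v =>
          obtain ⟨rfl, h1⟩ := Term.app.inj hD
          exact .inr (.inl ⟨0, by simp, D', by simp [argCtx, apps], h1⟩)
        | lam | bang | letArg _ | letBody _ => cases hD
    · exact .inr (.inl ⟨i + 1, by simpa using hi, D, rfl, hD⟩)
    · exact .inr (.inr ⟨j + 1, rfl, rfl⟩)

theorem plug_eq_mark {D : Ctx S} {r : Term S} {i : ℕ} (h : Ctx.plug D r = .mark i) :
    D = [] ∧ r = .mark i := by
  rcases D.eq_nil_or_concat with rfl | ⟨D', f, rfl⟩
  · exact ⟨rfl, h⟩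
  · rw [List.concat_eq_append, Ctx.plug_append] at h
    cases f <;> cases h

end Term

theorem enterArg_map_appL (vs : List (Term S)) : ∀ k : ℕ,
    enterArg k (vs.map Frame.appL) = none := by
  induction vs with
  | nil => intro k; cases k <;> rfl
  | cons v vs ih => intro k; cases k <;> simp [enterArg, ih]

theorem enterArg_map_appL_append (P : List (Frame S)) (vs : List (Term S)) {k : ℕ}
    (hk : vs.length = k) : enterArg k (vs.map Frame.appL ++ P) = none := by
  subst hk
  induction vs with
  | nil => simp [enterArg]
  | cons v vs ih => simp [enterArg, ih]

theorem enterArg_appR (t : Term S) (P : List (Frame S)) (vs : List (Term S)) :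
    ∀ (k i : ℕ) (hi : i < k), vs.length + i + 1 = k →
      enterArg k (vs.map Frame.appL ++ .appR t :: P) = some (⟨i, hi⟩, P) := by
  induction vs with
  | nil => rintro k i hi rfl; simp [enterArg, Fin.last]
  | cons v vs ih =>
    intro k i hi h
    obtain ⟨k, rfl⟩ : ∃ k', k = k' + 1 := ⟨k - 1, by omega⟩
    simp only [List.length_cons] at h
    simp [enterArg, ih k i (by omega) (by omega)]

theorem enterArg_argCtx (t : Term S) (us : List (Term S)) (P : List (Frame S)) {k : ℕ}
    (hk : us.length = k) (i : Fin k) :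
    enterArg k ((t.argCtx us i).reverse ++ P) = some (i, P) := by
  have := enterArg_appR (t.apps (us.take i)) P (us.drop (i + 1)).reverse k i i.2
    (by simp [hk]; omega)
  simpa [Term.argCtx] using this

/-- `followPath` ignores the side terms stored in the frames, so a path read in a substituted
context can be replayed in the original term. `E` accumulates the context already traversed. -/
theorem followPath_reverse (σ : ℕ → Term S) (D : Ctx S) : ∀ (r : Term S) (E : Ctx S),
    followPath (Ctx.sub σ D).reverse (Ctx.plug D r) E = (r, D ++ E) := by
  induction D using List.reverseRecOn with
  | nil => intro r E; unfold followPath; simp [Ctx.plug]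
  | append_singleton D f ih =>
    intro r E
    rw [Ctx.plug_append, Ctx.sub_append, List.reverse_append]
    cases f <;> simp [Ctx.plug, Frame.plug, Frame.sub, followPath, ih]

/-! ### Copies of the transition terms inside `τ̂` -/

namespace LambdaTransducer
variable (L : LambdaTransducer Γ S)

theorem trans_sub (a : Γ.Letter) (σ : ℕ → Term S) : (L.trans a).sub σ = L.trans a :=
  (L.trans_typed a).sub_eq σ

theorem out_sub (σ : ℕ → Term S) : L.out.sub σ = L.out := L.out_typed.sub_eq σ

/-- Substituting a variable for the formal constant would change the term, whereas typed terms are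
fixed. -/
theorem plug_mark_ne_trans (D : Ctx S) (i : ℕ) (a : Γ.Letter) :
    Ctx.plug D (.mark i) ≠ L.trans a := by
  intro h
  have := (Ctx.sub_eq_self_of_plug (fun _ => .var 0) D (.mark i) (h ▸ L.trans_sub a _)).2
  cases this

theorem plug_mark_ne_out (D : Ctx S) (i : ℕ) : Ctx.plug D (.mark i) ≠ L.out := by
  intro h
  have := (Ctx.sub_eq_self_of_plug (fun _ => .var 0) D (.mark i) (h ▸ L.out_sub _)).2
  cases this

/-- The context of `◊ᵢ` in `t_a ◊₁ ⋯ ◊ₖ`. -/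
def markCtx (a : Γ.Letter) (i : ℕ) : Ctx S :=
  (L.trans a).argCtx (List.ofFn fun i : Fin (Γ.rk a) => .mark i) i

theorem plug_markCtx (a : Γ.Letter) (i : Fin (Γ.rk a)) :
    Ctx.plug (L.markCtx a i) (.mark i) = L.marked a := by
  have := (L.trans a).plug_argCtx (List.ofFn fun i : Fin (Γ.rk a) => .mark i) i (by simp)
  rw [List.getElem_ofFn] at this
  exact this

/-- Each `◊ᵢ` occurs exactly once, so the context of a formal constant need not be stored in a
state. -/
theorem eq_markCtx {a : Γ.Letter} {D : Ctx S} {i : ℕ} (h : Ctx.plug D (.mark i) = L.marked a) :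
    i < Γ.rk a ∧ D = L.markCtx a i := by
  rcases Term.plug_eq_apps _ _ h with ⟨D', rfl, hD⟩ | ⟨j, hj, D', rfl, hD⟩ | ⟨j, -, hD⟩
  · exact absurd hD (L.plug_mark_ne_trans _ _ _)
  · obtain ⟨rfl, hD'⟩ := Term.plug_eq_mark (hD.trans (List.getElem_ofFn hj))
    obtain rfl := Term.mark.inj hD'
    exact ⟨by simpa using hj, rfl⟩
  · exact absurd (Term.eq_mark_of_apps _ _ hD.symm).symm (L.plug_mark_ne_trans [] _ _)

theorem marked_ne_mark (a : Γ.Letter) (i : ℕ) : L.marked a ≠ .mark i := fun h =>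
  L.plug_mark_ne_trans [] i a (Term.eq_mark_of_apps _ _ h).symm

/-- The terms that take the place of the formal constants in the copy of `t_a ◊₁ ⋯ ◊ₖ` at a
node. -/
def nodeSub : {τ : GroundTree Γ} → Node τ → ℕ → Term S
  | .leaf e, .root, _ => e.elim
  -- Out of range, the identity is an arbitrary closed term, so that `nodeSub_closed` holds for
  -- every index.
  | .node a ts, .root, i => if h : i < Γ.rk a then L.hat (ts ⟨i, h⟩) else .lam (.var 0)
  | _, .child _ ν, i => nodeSub ν i

/-- The context of `τ̂'` in `τ̂`, for the subtree `τ'` at a node. -/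
def hatCtx : {τ : GroundTree Γ} → Node τ → Ctx S
  | _, .root => []
  | .node a ts, .child i ν =>
    hatCtx ν ++ (L.trans a).argCtx (List.ofFn fun i => L.hat (ts i)) i

theorem nodeSub_root_map (a : Γ.Letter) (ts : Fin (Γ.rk a) → GroundTree Γ) :
    (List.ofFn fun i : Fin (Γ.rk a) => Term.mark (S := S) i).map
      (Term.sub (L.nodeSub (.root : Node (.node a ts)))) = List.ofFn fun i => L.hat (ts i) := by
  simp [List.map_ofFn, Function.comp_def, Term.sub, nodeSub]

theorem marked_sub_root (τ : GroundTree Γ) :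
    (L.marked (.root : Node τ).label).sub (L.nodeSub (.root : Node τ)) = L.hat τ := by
  cases τ with
  | leaf e => exact e.elim
  | node a ts =>
    rw [marked, Term.sub_apps, trans_sub]
    exact congrArg _ (L.nodeSub_root_map a ts)

/-- With `hatCtx_childAt`, this identifies `◊ᵢ` in the copy at `ν` with the whole copy at the `i`-th
child: both names denote the same term in the same context. It is what justifies the moves between
nodes. -/
theorem nodeSub_childAt {τ : GroundTree Γ} (ν : Node τ) (i : Fin ν.arity) :
    L.nodeSub ν i = (L.marked (ν.childAt i).label).sub (L.nodeSub (ν.childAt i)) := by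
  induction ν with
  | @root τ =>
    cases τ with
    | leaf e => exact e.elim
    | node a ts =>
      exact (dif_pos i.2).trans (L.marked_sub_root (ts i)).symm
  | child j ν ih => exact ih i

theorem hatCtx_childAt {τ : GroundTree Γ} (ν : Node τ) (i : Fin ν.arity) :
    L.hatCtx (ν.childAt i) = Ctx.sub (L.nodeSub ν) (L.markCtx ν.label i) ++ L.hatCtx ν := by
  induction ν with
  | @root τ =>
    cases τ with
    | leaf e => exact e.elim
    | node a ts =>
      have h : Ctx.sub (L.nodeSub (.root : Node (.node a ts))) (L.markCtx a i) =
          (L.trans a).argCtx (List.ofFn fun i => L.hat (ts i)) i := by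
        rw [markCtx, Term.argCtx_sub, trans_sub, nodeSub_root_map]
      exact h.symm.trans (List.append_nil _).symm
  | @child a ts j ν ih =>
    have := congrArg (· ++ (L.trans a).argCtx (List.ofFn fun i => L.hat (ts i)) j) (ih i)
    simp only [List.append_assoc] at this
    exact this

/-- Only a path ending at or below a formal constant enters an argument, so the descent stops at `ν`
when `r` is not one. -/
theorem locate_eq {τ : GroundTree Γ} (ν : Node τ) : ∀ {D : Ctx S} {r : Term S},
    Ctx.plug D r = L.marked ν.label → (∀ i, r ≠ .mark i) →
      locate τ (Ctx.sub (L.nodeSub ν) D ++ L.hatCtx ν).reverse =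
        (ν, (Ctx.sub (L.nodeSub ν) D).reverse) := by
  induction ν with
  | @root τ =>
    intro D r h hr
    cases τ with
    | leaf e => exact e.elim
    | node a ts =>
      have key : enterArg (Γ.rk a)
          (Ctx.sub (L.nodeSub (.root : Node (.node a ts))) D).reverse = none := by
        rcases Term.plug_eq_apps _ _ h with ⟨D', rfl, hD⟩ | ⟨j, hj, D', rfl, hD⟩ | ⟨j, rfl, -⟩
        · have := enterArg_map_appL_append (Ctx.sub (L.nodeSub (.root : Node (.node a ts)))
            D').reverse (List.ofFn fun i => L.hat (ts i)).reverse (k := Γ.rk a) (by simp)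
          refine (congrArg (enterArg _) ?_).trans this
          rw [← L.nodeSub_root_map a ts, Ctx.sub_append, List.reverse_append, ← List.map_reverse]
          simp [Ctx.sub, Function.comp_def, Frame.sub]
          rfl
        · exact absurd (Term.plug_eq_mark (hD.trans (List.getElem_ofFn hj))).2 (hr _)
        · have := enterArg_map_appL (((List.ofFn fun i : Fin (Γ.rk a) =>
            Term.mark (S := S) i).drop j).map
              (Term.sub (L.nodeSub (.root : Node (.node a ts))))).reverse (Γ.rk a)
          refine (congrArg (enterArg _) ?_).trans this
          simp [Ctx.sub, Function.comp_def, Frame.sub]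
          rfl
      simp [hatCtx, locate, key]
  | @child a ts j ν ih =>
    intro D r h hr
    have key := enterArg_argCtx (L.trans a) (List.ofFn fun i => L.hat (ts i))
      (Ctx.sub (L.nodeSub ν) D ++ L.hatCtx ν).reverse (List.length_ofFn) j
    have h1 : (Ctx.sub (L.nodeSub (.child j ν : Node (.node a ts))) D ++
        L.hatCtx (.child j ν : Node (.node a ts))).reverse =
        ((L.trans a).argCtx (List.ofFn fun i => L.hat (ts i)) j).reverse ++
          (Ctx.sub (L.nodeSub ν) D ++ L.hatCtx ν).reverse := by
      rw [← List.reverse_append, List.append_assoc]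
      rfl
    rw [h1, locate]
    simp only [key, ih h hr]
    rfl

/-- A position at or inside an argument is attributed to the child, which is why `r` is never a
formal constant. -/
theorem exists_position (τ : GroundTree Γ) : ∀ {C : Ctx S} {t : Term S},
    Ctx.plug C t = L.hat τ → ∃ (ν : Node τ) (r : Term S) (D : Ctx S),
      t = r.sub (L.nodeSub ν) ∧ C = Ctx.sub (L.nodeSub ν) D ++ L.hatCtx ν ∧
        Ctx.plug D r = L.marked ν.label ∧ ∀ i, r ≠ .mark i := by
  induction τ with
  | leaf e => exact e.elim
  | node a ts ih =>
    intro C t h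
    rcases Term.plug_eq_apps _ _ h with ⟨D, rfl, hD⟩ | ⟨j, hj, D, rfl, hD⟩ | ⟨j, rfl, rfl⟩
    · obtain ⟨h1, h2⟩ := Ctx.sub_eq_self_of_plug (L.nodeSub (.root : Node (.node a ts))) D t
        (by rw [hD, trans_sub])
      refine ⟨.root, t, D ++ (List.ofFn fun i : Fin (Γ.rk a) => Term.mark i).map .appL, h2.symm,
        ?_, ?_, ?_⟩
      · rw [Ctx.sub_append, h1, ← L.nodeSub_root_map a ts]
        simp [hatCtx, Ctx.sub, Frame.sub, Function.comp_def]
      · rw [Ctx.plug_append, hD, Term.plug_map_appL]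
        rfl
      · rintro i rfl
        exact L.plug_mark_ne_trans _ _ _ hD
    · have hj' : j < Γ.rk a := by simpa using hj
      obtain ⟨ν, r, D', h1, h2, h3, h4⟩ := ih ⟨j, hj'⟩ (hD.trans (List.getElem_ofFn hj))
      refine ⟨.child ⟨j, hj'⟩ ν, r, D', h1, ?_, h3, h4⟩
      rw [h2, List.append_assoc]
      rfl
    · refine ⟨.root, (L.trans a).apps ((List.ofFn fun i : Fin (Γ.rk a) => Term.mark i).take j),
        ((List.ofFn fun i : Fin (Γ.rk a) => Term.mark i).drop j).map .appL, ?_, ?_, ?_, ?_⟩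
      · rw [Term.sub_apps, trans_sub, List.map_take, nodeSub_root_map]
      · rw [← L.nodeSub_root_map a ts]
        simp [hatCtx, Ctx.sub, Frame.sub, Function.comp_def]
      · rw [Term.plug_map_appL, ← Term.apps_append, List.take_append_drop]
        rfl
      · intro i hi
        exact L.plug_mark_ne_trans [] _ _ (Term.eq_mark_of_apps _ _ hi).symm

theorem nodeSub_closed {P : Ty → Prop} (hL : L.Fragment P) (ht : ∀ a, (L.trans a).Normal)
    {τ : GroundTree Γ} (ν : Node τ) (i : ℕ) : (L.nodeSub ν i).Closed 0 := by
  induction ν with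
  | @root τ =>
    cases τ with
    | leaf e => exact e.elim
    | node a ts =>
      rw [nodeSub]
      split_ifs with h
      · exact (hL.hat_typed ht _).closed
      · exact Nat.zero_lt_one
  | child j ν ih => exact ih

end LambdaTransducer

/-! ### Parents and children of nodes -/

namespace Node

theorem parent_childAt {τ : GroundTree Γ} (ν : Node τ) (i : Fin ν.arity) :
    (ν.childAt i).parent = some ⟨ν, i⟩ := by
  induction ν with
  | @root τ =>
    cases τ with
    | leaf e => exact e.elim
    | node a ts => rfl
  | child j ν ih =>
    change (child j (ν.childAt i)).parent = _
    rw [parent, ih i]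

theorem eq_root_of_parent {τ : GroundTree Γ} {ν : Node τ} (h : ν.parent = none) :
    ν = .root := by
  cases ν with
  | root => rfl
  | child i ν =>
    rw [parent] at h
    split at h <;> cases h

theorem eq_childAt_of_parent {τ : GroundTree Γ} {ν : Node τ} : ∀ {ξ : Node τ}
    {j : Fin ξ.arity}, ν.parent = some ⟨ξ, j⟩ → ν = ξ.childAt j := by
  induction ν with
  | @root τ => intro ξ j h; cases τ <;> cases h
  | @child a ts i ν ih =>
    intro ξ j h
    rw [parent] at h
    split at h
    · rename_i h'
      cases h
      rw [eq_root_of_parent h']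
      rfl
    · rename_i ξ' j' h'
      cases h
      rw [ih h']
      rfl

end Node


/-! Finiteness of the set of states -/

/-- Peeling off the outermost frame leaves a decomposition of an immediate subterm, and a term has
at most two of these. -/
theorem finite_decompositions (v : Term S) :
    {p : Term S × Ctx S | Ctx.plug p.2 p.1 = v}.Finite := by
  have key : ∀ v : Term S, {p : Term S × Ctx S | Ctx.plug p.2 p.1 = v} ⊆
      {(v, [])} ∪ ⋃ (f : {fw : Frame S × Term S // fw.1.plug fw.2 = v}),
        (fun p : Term S × Ctx S => (p.1, p.2 ++ [f.1.1])) ''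
          {p : Term S × Ctx S | Ctx.plug p.2 p.1 = f.1.2} := by
    rintro v ⟨t, C⟩ h
    rcases C.eq_nil_or_concat with rfl | ⟨D, f, rfl⟩
    · exact .inl (by simpa [Ctx.plug] using h)
    · rw [List.concat_eq_append, Set.mem_ofPred_eq, Ctx.plug_append] at h
      refine .inr (Set.mem_iUnion.2 ⟨⟨(f, Ctx.plug D t), h⟩, (t, D), rfl, by simp⟩)
  have step : ∀ v : Term S, {fw : Frame S × Term S | fw.1.plug fw.2 = v}.Finite →
      (∀ (f : Frame S) (w : Term S), f.plug w = v →
        {p : Term S × Ctx S | Ctx.plug p.2 p.1 = w}.Finite) →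
      {p : Term S × Ctx S | Ctx.plug p.2 p.1 = v}.Finite := by
    intro v hv h
    have : Finite {fw : Frame S × Term S // fw.1.plug fw.2 = v} := hv.to_subtype
    exact ((Set.finite_singleton _).union (Set.finite_iUnion
      fun f : {fw : Frame S × Term S // fw.1.plug fw.2 = v} =>
      (h f.1.1 f.1.2 f.2).image _)).subset (key v)
  induction v with
  | const c | mark i | var n =>
    refine step _ (Set.Finite.subset Set.finite_empty ?_) ?_
    · rintro ⟨f, w⟩ h; cases f <;> cases h
    · intro f w h; cases f <;> cases h
  | lam t ih =>
    refine step _ (Set.Finite.subset (Set.finite_singleton (.lam, t)) ?_) ?_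
    · rintro ⟨f, w⟩ h; cases f <;> cases h; rfl
    · intro f w h; cases f <;> cases h; exact ih
  | bang t ih =>
    refine step _ (Set.Finite.subset (Set.finite_singleton (.bang, t)) ?_) ?_
    · rintro ⟨f, w⟩ h; cases f <;> cases h; rfl
    · intro f w h; cases f <;> cases h; exact ih
  | app t u iht ihu =>
    refine step _ (Set.Finite.subset (Set.toFinite {(.appL u, t), (.appR t, u)}) ?_) ?_
    · rintro ⟨f, w⟩ h; cases f <;> cases h <;> simp
    · intro f w h; cases f <;> cases h <;> assumption
  | letb u t ihu iht =>
    refine step _ (Set.Finite.subset (Set.toFinite {(.letArg t, u), (.letBody u, t)}) ?_) ?_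
    · rintro ⟨f, w⟩ h; cases f <;> cases h <;> simp
    · intro f w h; cases f <;> cases h <;> assumption

theorem finite_tapes (H : ℕ) : {T : Tape | T.length ≤ H}.Finite := by
  have : Finite Sym := Finite.of_injective (fun s : Sym => decide (s = .p)) (by
    intro a b h; cases a <;> cases b <;> simp_all)
  exact List.finite_length_le Sym H

theorem finite_polarity : Finite Polarity :=
  Finite.of_injective (fun d : Polarity => match d with | .down => true | .up => false) (by
    intro a b h; cases a <;> cases b <;> simp_all)

theorem LambdaTransducer.finite_Q (L : LambdaTransducer Γ S) (H : ℕ) : Finite (L.Q H) := by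
  have := finite_polarity
  have := Γ.finite
  have hT := finite_tapes H
  have h1 : (⋃ a, {p : Term S × Ctx S | Ctx.plug p.2 p.1 = L.marked a}).Finite :=
    Set.finite_iUnion fun a => finite_decompositions _
  have h2 := finite_decompositions L.out
  have hd := Set.finite_univ (α := Polarity)
  refine Set.Finite.to_subtype (s := {q : State S | L.IsState H q}) ?_
  refine ((((Set.finite_singleton State.I).union
    ((hd.prod (h1.prod hT)).image fun x => State.T x.1 x.2.1.1 x.2.1.2 x.2.2)).union
    ((hd.prod (h2.prod hT)).image fun x => State.U x.1 x.2.1.1 x.2.1.2 x.2.2)).union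
    ((hT.image State.nabla).union (hT.image State.delta))).subset ?_
  intro q hq
  cases q with
  | I => simp
  | T d t C T =>
    obtain ⟨⟨a, ha⟩, -, -, hT⟩ := hq
    exact .inl (.inl (.inr ⟨(d, (t, C), T), ⟨trivial, Set.mem_iUnion.2 ⟨a, ha⟩, hT⟩, rfl⟩))
  | U d t C T =>
    exact .inl (.inr ⟨(d, (t, C), T), ⟨trivial, hq.1, hq.2⟩, rfl⟩)
  | nabla T => exact .inr (.inl ⟨T, hq, rfl⟩)
  | delta T => exact .inr (.inr ⟨T, hq, rfl⟩)

/-! Partial functions induced by the interaction abstract machine on a term -/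

section
variable {X Z : Type}

open Classical in
/-- Decode `x` as a configuration located in `w`, perform one step, and encode the result. -/
noncomputable def localStep (w : Term S) (entry exit : X → Option (RawConfig S)) (x : X) :
    Option (Tree S X) :=
  -- A state may encode a position in the term of another letter. Requiring `c.term = w` leaves the
  -- map undefined there, and gives the typing needed for reversibility.
  if h : ∃ (t : Tree S X) (c : RawConfig S) (s : Tree S (RawConfig S)), entry x = some c ∧
      c.term = w ∧ rawStep c = some s ∧ t.map exit = s.map some then some h.choose else none

theorem of_localStep_eq_some {w : Term S} {entry exit : X → Option (RawConfig S)} {x : X}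
    {t : Tree S X} (h : localStep w entry exit x = some t) :
    ∃ (c : RawConfig S) (s : Tree S (RawConfig S)), entry x = some c ∧
      c.term = w ∧ rawStep c = some s ∧ t.map exit = s.map some := by
  rw [localStep] at h
  split_ifs at h with h'
  obtain rfl := Option.some.inj h
  exact h'.choose_spec

theorem of_localStep_eq_none {w : Term S} {entry exit : X → Option (RawConfig S)} {x : X}
    (h : localStep w entry exit x = none) (t : Tree S X) (c : RawConfig S)
    (s : Tree S (RawConfig S)) (hx : entry x = some c) (hc : c.term = w)
    (hs : rawStep c = some s) : t.map exit ≠ s.map some := by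
  intro ht
  rw [localStep] at h
  split_ifs at h with h'
  exact h' ⟨t, c, s, hx, hc, hs, ht⟩

/-- A leaf `y` decodes to a single configuration, `rawPred` gives its only source, and the encoding
of sources is injective. Injectivity of `exit` is not needed, only that it is a function. -/
theorem localStep_leafInjective {P : Ty → Prop} {m A : Ty} (hP : ∀ A, ¬ P (.bang A)) {w : Term S}
    (hw : HasTypeIn P m [] w A) {entry exit : X → Option (RawConfig S)}
    (hentry : ∀ x x' c, entry x = some c → entry x' = some c → x = x') :
    TWT.LeafInjective (localStep w entry exit) := by
  constructor
  · intro x t ht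
    obtain ⟨c, s, -, -, hs, hts⟩ := of_localStep_eq_some ht
    have h := congrArg Tree.leaves hts
    rw [Tree.leaves_map, Tree.leaves_map] at h
    refine List.Nodup.of_map exit ?_
    rw [h]
    exact (rawStep_leaves_nodup hs).map (Option.some_injective _)
  · intro x x' t t' y ht ht' hy hy'
    obtain ⟨c, s, hx, hc, hs, hts⟩ := of_localStep_eq_some ht
    obtain ⟨c', s', hx', hc', hs', hts'⟩ := of_localStep_eq_some ht'
    have h := congrArg Tree.leaves hts
    have h' := congrArg Tree.leaves hts'
    rw [Tree.leaves_map, Tree.leaves_map] at h h'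
    have hm : exit y ∈ s.leaves.map some := h ▸ List.mem_map_of_mem hy
    have hm' : exit y ∈ s'.leaves.map some := h' ▸ List.mem_map_of_mem hy'
    obtain ⟨e, he, hye⟩ := List.mem_map.1 hm
    obtain ⟨e', he', hye'⟩ := List.mem_map.1 hm'
    obtain rfl : e = e' := Option.some.inj (hye.trans hye'.symm)
    have h1 := rawPred_of_mem hP (hc ▸ hw) hs he
    have h2 := rawPred_of_mem hP (hc' ▸ hw) hs' he'
    obtain rfl : c = c' := Option.some.inj (h1.symm.trans h2)
    exact hentry _ _ _ hx hx'

/-- If encodings of configurations in `w` represent the corresponding configurations in a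
larger term `v`, then `localStep w` represents the step function on `v`. -/
theorem localStep_simulation {σ : ℕ → Term S} (hσ : ∀ i, (σ i).Closed 0) (C₀ : Ctx S)
    {v w : Term S} (hw : w.Closed 0) {entry exit : X → Option (RawConfig S)} {x : X}
    {c : RawConfig S} {κ : IAMConfig v} (hx : entry x = some c) (hc : c.term = w)
    (hκ : κ.raw = c.lift σ C₀) (hdown : c.dir = .down → ∀ i, c.focus ≠ .mark i)
    (hup : c.dir = .up → c.ctx = [] → C₀ = []) (F : IAMConfig v → Z) (g : X → Z)
    (hexit : ∀ (κ' : IAMConfig v) (c' : RawConfig S), (apaiam v).Succ κ κ' →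
      κ'.raw = c'.lift σ C₀ → c'.term = w → (c'.dir = .down → c'.ctx ≠ []) →
      (c'.dir = .up → ∀ i, c'.focus ≠ .mark i) → ∃ y, exit y = some c')
    (hmove : ∀ (κ' : IAMConfig v) (c' : RawConfig S) (y : X), exit y = some c' →
      κ'.raw = c'.lift σ C₀ → c'.term = w → F κ' = g y) :
    (localStep w entry exit x).map (Tree.map g) = (iamStep v κ).map (Tree.map F) := by
  have h := iamStep_map_raw κ
  rw [hκ, rawStep_lift hσ C₀ c (hc ▸ hw) hdown hup] at h
  cases hs : rawStep c with
  | none =>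
    rw [hs] at h
    cases h1 : iamStep v κ with
    | some s => rw [h1] at h; cases h
    | none =>
      cases h2 : localStep w entry exit x with
      | none => rfl
      | some t =>
        obtain ⟨c', s, hx', -, hs', -⟩ := of_localStep_eq_some h2
        obtain rfl : c = c' := Option.some.inj (hx.symm.trans hx')
        rw [hs] at hs'
        cases hs'
  | some s =>
    rw [hs] at h
    cases h1 : iamStep v κ with
    | none => rw [h1] at h; cases h
    | some r =>
      rw [h1] at h
      replace h : r.map IAMConfig.raw = s.map (RawConfig.lift σ C₀) := Option.some.inj h
      obtain ⟨t, ht⟩ : ∃ t : Tree S X, t.map exit = s.map some := by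
        refine Tree.exists_map_eq _ _ _ fun c' hc' => ?_
        obtain ⟨h2, h3, h4⟩ := rawStep_target hs hc'
        have h5 : c'.lift σ C₀ ∈ (r.map IAMConfig.raw).leaves := by
          rw [h, Tree.leaves_map]
          exact List.mem_map_of_mem hc'
        rw [Tree.leaves_map] at h5
        obtain ⟨κ', hκ', h5⟩ := List.mem_map.1 h5
        exact hexit κ' c' ⟨r, h1, hκ'⟩ h5 (h2.trans hc) h3 h4
      cases h2 : localStep w entry exit x with
      | none => exact absurd ht (of_localStep_eq_none h2 t c s hx hc hs)
      | some t' =>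
        obtain ⟨c', s', hx', -, hs', ht'⟩ := of_localStep_eq_some h2
        obtain rfl : c = c' := Option.some.inj (hx.symm.trans hx')
        obtain rfl : s = s' := Option.some.inj (hs.symm.trans hs')
        -- The chosen `t'` may differ from the tree `t` constructed above, but its leaves decode to
        -- the same configurations, which determine the result.
        refine congrArg some (Tree.map_eq_map_of_common s r t' h ht' ?_).symm
        intro κ' _ c' hc' y _ h5 h6
        exact hmove κ' c' y h6 h5 ((rawStep_target hs hc').1.trans hc)

end

namespace LambdaTransducer
variable (L : LambdaTransducer Γ S)

/-! The transition functions -/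

/-- The configuration in `t_a ◊₁ ⋯ ◊ₖ` described by a state and a provenance. -/
def entry (a : Γ.Letter) : State S × Dir (Γ.rk a) → Option (RawConfig S)
  | (.T d r D T, .stay) => some ⟨d, r, D, T⟩
  | (.nabla T, .parent) => some ⟨.down, L.marked a, [], T⟩
  | (.delta T, .child i) => some ⟨.up, .mark i, L.markCtx a i, T⟩
  | _ => none

/-- The configuration in `t_a ◊₁ ⋯ ◊ₖ` described by a state and a move. -/
def exit (a : Γ.Letter) : State S × Dir (Γ.rk a) → Option (RawConfig S)
  | (.T d r D T, .stay) => some ⟨d, r, D, T⟩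
  | (.nabla T, .child i) => some ⟨.down, .mark i, L.markCtx a i, T⟩
  | (.delta T, .parent) => some ⟨.up, L.marked a, [], T⟩
  | _ => none

/-- The configuration in `u (t_a ◊₁ ⋯ ◊ₖ)` described by a state and a provenance. -/
def rootEntry (a : Γ.Letter) : State S × RootDir (Γ.rk a) → Option (RawConfig S)
  | (.I, .stay) => some ⟨.down, .app L.out (L.marked a), [], []⟩
  | (.U d t C T, .stay) => some ⟨d, t, C ++ [.appL (L.marked a)], T⟩
  | (.T d r D T, .stay) => some ⟨d, r, D ++ [.appR L.out], T⟩
  | (.nabla T, .stay) => some ⟨.down, L.marked a, [.appR L.out], T⟩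
  | (.delta T, .stay) => some ⟨.up, L.marked a, [.appR L.out], T⟩
  | (.delta T, .child i) => some ⟨.up, .mark i, L.markCtx a i ++ [.appR L.out], T⟩
  | _ => none

/-- The configuration in `u (t_a ◊₁ ⋯ ◊ₖ)` described by a state and a move. -/
def rootExit (a : Γ.Letter) : State S × RootDir (Γ.rk a) → Option (RawConfig S)
  -- There is no clause for `I`: no step leads back to the whole term in a run. The root has no
  -- parent, so crossing between `u` and `τ̂` is a move on the spot.
  | (.U d t C T, .stay) => some ⟨d, t, C ++ [.appL (L.marked a)], T⟩
  | (.T d r D T, .stay) => some ⟨d, r, D ++ [.appR L.out], T⟩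
  | (.nabla T, .stay) => some ⟨.down, L.marked a, [.appR L.out], T⟩
  | (.delta T, .stay) => some ⟨.up, L.marked a, [.appR L.out], T⟩
  | (.nabla T, .child i) => some ⟨.down, .mark i, L.markCtx a i ++ [.appR L.out], T⟩
  | _ => none

/-- The tree-walking transducer that simulates the interaction abstract machine. -/
noncomputable def toTWT (H : ℕ) : TWT Γ S (L.Q H) where
  finite := L.finite_Q H
  init := L.initState H
  δ a := localStep (L.marked a) (fun x => L.entry a (x.1.1, x.2)) fun x => L.exit a (x.1.1, x.2)
  δroot a := localStep (.app L.out (L.marked a)) (fun x => L.rootEntry a (x.1.1, x.2))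
    fun x => L.rootExit a (x.1.1, x.2)

/-- The conditions on `T` states, a nonempty context and a focus that is not a formal constant,
separate them from the configurations encoded by `∇` and `Δ`. -/
theorem entry_inj {H : ℕ} {a : Γ.Letter} {q q' : State S} {p p' : Dir (Γ.rk a)}
    {c : RawConfig S} (hq : L.IsState H q) (hq' : L.IsState H q')
    (h : L.entry a (q, p) = some c) (h' : L.entry a (q', p') = some c) : q = q' ∧ p = p' := by
  cases q <;> cases p <;> cases h <;> cases q' <;> cases p' <;>
    simp_all [entry, IsState, Fin.ext_iff]
  all_goals
    obtain ⟨-, rfl, -⟩ := h'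
    simp at hq

theorem rootEntry_inj {H : ℕ} {a : Γ.Letter} {q q' : State S} {p p' : RootDir (Γ.rk a)}
    {c : RawConfig S} (hq : L.IsState H q) (hq' : L.IsState H q')
    (h : L.rootEntry a (q, p) = some c) (h' : L.rootEntry a (q', p') = some c) :
    q = q' ∧ p = p' := by
  have h0 : ∀ C : Ctx S, C ++ [.appL (L.marked a)] ≠ [.appR L.out] := by
    intro C h
    have := List.append_singleton_inj.1 (h.trans (List.nil_append _).symm)
    simp at this
  have h1 := fun C => (h0 C).symm
  have h2 := L.marked_ne_mark a
  have h3 := fun i => (h2 i).symm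
  cases q <;> cases p <;> cases h <;> cases q' <;> cases p' <;>
    simp_all [rootEntry, IsState, Fin.ext_iff, List.append_singleton_inj]
  all_goals
    obtain ⟨-, rfl, -⟩ := h'
    simp at hq

theorem toTWT_reversible (H : ℕ) (hA : L.memory.PurelyAffine) (hu : L.out.Normal)
    (ht : ∀ a, (L.trans a).Normal) : (L.toTWT H).Reversible := by
  have hL := L.fragment_purelyAffine hA
  have hP : ∀ A, ¬ Ty.PurelyAffine (.bang A) := fun A h => h
  exact fun a => ⟨
    localStep_leafInjective hP (hL.marked_typed ht a) fun x x' c h h' =>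
      have e := L.entry_inj x.1.2 x'.1.2 h h'
      Prod.ext (Subtype.ext e.1) e.2,
    localStep_leafInjective hP (hL.app_out_typed hu (hL.marked_typed ht a)) fun x x' c h h' =>
      have e := L.rootEntry_inj x.1.2 x'.1.2 h h'
      Prod.ext (Subtype.ext e.1) e.2⟩

end LambdaTransducer

namespace LambdaTransducer
variable (L : LambdaTransducer Γ S)

/-! The translation of configurations -/

section
variable {L} {τ : GroundTree Γ} {κ : IAMConfig (L.program τ)}

theorem sim_of_nil (h : κ.ctx = []) : L.sim τ κ = ⟨.I, .root, .stay⟩ := by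
  unfold sim
  rw [h]
  rfl

theorem sim_of_appL {D : Ctx S} {t : Term S} (h : κ.ctx = D ++ [.appL t]) :
    L.sim τ κ = ⟨.U κ.dir κ.focus D κ.tape, .root, .stay⟩ := by
  have h1 : κ.ctx.reverse = .appL t :: D.reverse := by simp [h]
  unfold sim
  rw [h1]
  simp

/-- The configuration is at the position described by `r` and `D` in the copy of
`t_a ◊₁ ⋯ ◊ₖ` at the node `ν`. -/
structure IsAt (κ : IAMConfig (L.program τ)) (ν : Node τ) (r : Term S) (D : Ctx S) : Prop where
  ctx : ∃ t, κ.ctx = Ctx.sub (L.nodeSub ν) D ++ L.hatCtx ν ++ [.appR t]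
  plug : Ctx.plug D r = L.marked ν.label
  ne_mark : ∀ i, r ≠ .mark i

variable {ν : Node τ} {r : Term S} {D : Ctx S}

theorem IsAt.sim_eq (h : IsAt κ ν r D) : L.sim τ κ =
    match (Ctx.sub (L.nodeSub ν) D).reverse, κ.dir, ν.parent with
    | [], .down, none => ⟨.nabla κ.tape, ν, .stay⟩
    | [], .down, some _ => ⟨.nabla κ.tape, ν, .parent⟩
    | [], .up, none => ⟨.delta κ.tape, ν, .stay⟩
    | [], .up, some ⟨ξ, i⟩ => ⟨.delta κ.tape, ξ, .child i⟩
    | f :: P', d, _ =>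
      let r := followPath (f :: P') (L.marked ν.label) []
      ⟨.T d r.1 r.2 κ.tape, ν, .stay⟩ := by
  obtain ⟨t, ht⟩ := h.ctx
  have h1 : κ.ctx.reverse = .appR t :: (Ctx.sub (L.nodeSub ν) D ++ L.hatCtx ν).reverse := by
    simp [ht]
  unfold sim
  rw [h1]
  dsimp only
  rw [L.locate_eq ν h.plug h.ne_mark]
  dsimp only
  generalize (Ctx.sub (L.nodeSub ν) D).reverse = P
  generalize κ.dir = d
  generalize ν.parent = o
  cases P <;> cases d <;> cases o <;> rfl

theorem IsAt.sim_inner (h : IsAt κ ν r D) (hD : D ≠ []) :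
    L.sim τ κ = ⟨.T κ.dir r D κ.tape, ν, .stay⟩ := by
  have h1 : followPath (Ctx.sub (L.nodeSub ν) D).reverse (L.marked ν.label) [] = (r, D) := by
    rw [← h.plug, followPath_reverse, List.append_nil]
  rw [h.sim_eq]
  split
  · simp_all
  · simp_all
  · simp_all
  · simp_all
  · rename_i f P' d _ hf
    rw [hf] at h1
    simp only [h1]

theorem IsAt.sim_down_root (h : IsAt κ ν r []) (hd : κ.dir = .down) (hp : ν.parent = none) :
    L.sim τ κ = ⟨.nabla κ.tape, ν, .stay⟩ := by
  rw [h.sim_eq, hd, hp]; rfl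

theorem IsAt.sim_down {ξ : Node τ} {j : Fin ξ.arity} (h : IsAt κ ν r []) (hd : κ.dir = .down)
    (hp : ν.parent = some ⟨ξ, j⟩) : L.sim τ κ = ⟨.nabla κ.tape, ν, .parent⟩ := by
  rw [h.sim_eq, hd, hp]; rfl

theorem IsAt.sim_up_root (h : IsAt κ ν r []) (hd : κ.dir = .up) (hp : ν.parent = none) :
    L.sim τ κ = ⟨.delta κ.tape, ν, .stay⟩ := by
  rw [h.sim_eq, hd, hp]; rfl

theorem IsAt.sim_up {ξ : Node τ} {j : Fin ξ.arity} (h : IsAt κ ν r []) (hd : κ.dir = .up)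
    (hp : ν.parent = some ⟨ξ, j⟩) : L.sim τ κ = ⟨.delta κ.tape, ξ, .child j⟩ := by
  rw [h.sim_eq, hd, hp]; rfl

end

theorem hatCtx_of_parent {τ : GroundTree Γ} {ν : Node τ} (h : ν.parent = none) :
    L.hatCtx ν = [] := by
  rw [Node.eq_root_of_parent h, hatCtx]

theorem hat_eq_of_parent {τ : GroundTree Γ} {ν : Node τ} (h : ν.parent = none) :
    (L.marked ν.label).sub (L.nodeSub ν) = L.hat τ := by
  obtain rfl := Node.eq_root_of_parent h
  exact L.marked_sub_root τ

theorem sub_of_plug_out {C : Ctx S} {t : Term S} (h : Ctx.plug C t = L.out) (σ : ℕ → Term S) :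
    Ctx.sub σ C = C ∧ t.sub σ = t :=
  Ctx.sub_eq_self_of_plug σ C t (by rw [h, out_sub])

/-- A move leads to the translation of the configuration that it encodes. -/
theorem sim_eq_move {τ : GroundTree Γ} {H : ℕ} {κ : IAMConfig (L.program τ)} {ν ξ : Node τ}
    {j : Fin ξ.arity} (hν : ν.parent = some ⟨ξ, j⟩) {q : State S} {p : Dir ν.arity}
    {c : RawConfig S} (hq : L.IsState H q) (h : L.exit ν.label (q, p) = some c)
    (hκ : κ.raw = c.lift (L.nodeSub ν) (L.hatCtx ν ++ [.appR L.out]))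
    (hc : c.term = L.marked ν.label) : L.sim τ κ = TWT.move ν ξ j (q, p) := by
  obtain ⟨d, t, C, T, hv⟩ := κ
  cases q with
  | I => cases p <;> cases h
  | T d' r D T' =>
    cases p with
    | parent | child _ => cases h
    | stay =>
      obtain ⟨-, hD, hr, -⟩ := hq
      cases h
      cases hκ
      exact IsAt.sim_inner ⟨⟨_, (List.append_assoc _ _ _).symm⟩, hc, hr⟩ hD
  | U => cases p <;> cases h
  | nabla T' =>
    cases p with
    | parent | stay => cases h
    | child i =>
      cases h
      simp only [IAMConfig.raw, RawConfig.lift, RawConfig.mk.injEq] at hκ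
      obtain ⟨rfl, rfl, rfl, rfl⟩ := hκ
      -- After substitution, going down on `◊ᵢ` is going down on the whole copy at the `i`-th child.
      refine IsAt.sim_down (ν := ν.childAt i) (r := L.marked (ν.childAt i).label) ⟨⟨L.out, ?_⟩,
        rfl, L.marked_ne_mark _⟩ rfl (ν.parent_childAt i)
      simp [hatCtx_childAt]
  | delta T' =>
    cases p with
    | child _ | stay => cases h
    | parent =>
      cases h
      cases hκ
      exact IsAt.sim_up (r := L.marked ν.label) ⟨⟨L.out, by simp⟩, rfl, L.marked_ne_mark _⟩
        rfl hν

theorem sim_eq_moveRoot {τ : GroundTree Γ} {H : ℕ} {κ : IAMConfig (L.program τ)} {ν : Node τ}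
    (hν : ν.parent = none) {q : State S} {p : RootDir ν.arity} {c : RawConfig S}
    (hq : L.IsState H q) (h : L.rootExit ν.label (q, p) = some c)
    (hκ : κ.raw = c.lift (L.nodeSub ν) [])
    (hc : c.term = .app L.out (L.marked ν.label)) : L.sim τ κ = TWT.moveRoot ν (q, p) := by
  have hctx := L.hatCtx_of_parent hν
  obtain ⟨d, t, C, T, hv⟩ := κ
  cases q with
  | I => cases p <;> cases h
  | T d' r D T' =>
    cases p with
    | child _ => cases h
    | stay =>
      obtain ⟨-, hD, hr, -⟩ := hq
      cases h
      cases hκ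
      rw [RawConfig.term, Ctx.plug_append] at hc
      exact IsAt.sim_inner ⟨⟨L.out, by simp [hctx, Frame.sub, out_sub]⟩,
        (Term.app.inj hc).2, hr⟩ hD
  | U d' t' D T' =>
    cases p with
    | child _ => cases h
    | stay =>
      obtain ⟨h1, h2⟩ := L.sub_of_plug_out hq.1 (L.nodeSub ν)
      cases h
      cases hκ
      rw [sim_of_appL (D := D) (t := L.hat τ) (by
        simp [h1, Frame.sub, L.hat_eq_of_parent hν])]
      simp only [h2, TWT.moveRoot]
      rw [Node.eq_root_of_parent hν]
  | nabla T' =>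
    cases p with
    | stay =>
      cases h
      cases hκ
      exact IsAt.sim_down_root (r := L.marked ν.label) ⟨⟨L.out, by
        simp [hctx, Frame.sub, out_sub]⟩, rfl, L.marked_ne_mark _⟩ rfl hν
    | child i =>
      cases h
      simp only [IAMConfig.raw, RawConfig.lift, RawConfig.mk.injEq] at hκ
      obtain ⟨rfl, rfl, rfl, rfl⟩ := hκ
      refine IsAt.sim_down (ν := ν.childAt i) (r := L.marked (ν.childAt i).label) ⟨⟨L.out, ?_⟩,
        rfl, L.marked_ne_mark _⟩ rfl (ν.parent_childAt i)
      simp [hatCtx_childAt, hctx, Frame.sub, out_sub]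
  | delta T' =>
    cases p with
    | child _ => cases h
    | stay =>
      cases h
      cases hκ
      exact IsAt.sim_up_root (r := L.marked ν.label) ⟨⟨L.out, by
        simp [hctx, Frame.sub, out_sub]⟩, rfl, L.marked_ne_mark _⟩ rfl hν

/-- The direction around a node given by a direction around the root. -/
def _root_.LamTWT.RootDir.toDir {k : ℕ} : RootDir k → Dir k
  | .stay => .stay
  | .child i => .child i

/-- The state and provenance at a node describe the configuration. -/
def Describes {τ : GroundTree Γ} (q : State S) (ν : Node τ) (p : Dir ν.arity)
    (c₀ : RawConfig S) : Prop :=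
  (∃ ξ j c, ν.parent = some ⟨ξ, j⟩ ∧ L.entry ν.label (q, p) = some c ∧
    c.term = L.marked ν.label ∧
    c₀ = c.lift (L.nodeSub ν) (L.hatCtx ν ++ [.appR L.out])) ∨
  (∃ p' c, ν.parent = none ∧ p = p'.toDir ∧ L.rootEntry ν.label (q, p') = some c ∧
    c.term = .app L.out (L.marked ν.label) ∧ c₀ = c.lift (L.nodeSub ν) [])

/-- The case analysis follows the position: the whole term, `u`, or a copy at a node, then whether
that node is the root and whether the focus is its entire copy. `hnil` ensures that the whole term
is met only in the initial configuration. -/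
theorem exists_describes {τ : GroundTree Γ} {H : ℕ} (κ : IAMConfig (L.program τ))
    (hH : κ.tape.length ≤ H) (hnil : κ.ctx = [] → κ.dir = .down ∧ κ.tape = []) :
    ∃ q ν p, L.IsState H q ∧ L.sim τ κ = ⟨q, ν, p⟩ ∧ L.Describes q ν p κ.raw := by
  obtain ⟨d, t, C, T, hv⟩ := κ
  rcases C.eq_nil_or_concat with rfl | ⟨C', f, rfl⟩
  · obtain ⟨rfl, rfl⟩ := hnil rfl
    refine ⟨.I, .root, .stay, trivial, sim_of_nil rfl, .inr ⟨.stay, _, rfl, rfl, rfl, rfl, ?_⟩⟩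
    have : t = .app L.out (L.hat τ) := hv
    simp [RawConfig.lift, IAMConfig.raw, Term.sub, marked_sub_root, out_sub, this]
  · simp only [List.concat_eq_append] at hv hnil ⊢
    have hv' := hv
    rw [Ctx.plug_append] at hv'
    cases f with
    | lam | bang | letArg _ | letBody _ => cases hv'
    | appL u =>
      obtain ⟨h1, h2⟩ := Term.app.inj hv'
      obtain ⟨h3, h4⟩ := L.sub_of_plug_out h1 (L.nodeSub (.root : Node τ))
      refine ⟨.U d t C' T, .root, .stay, ⟨h1, hH⟩, sim_of_appL rfl,
        .inr ⟨.stay, _, rfl, rfl, rfl, ?_, ?_⟩⟩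
      · rw [RawConfig.term, Ctx.plug_append, h1]
        rfl
      · simp [RawConfig.lift, IAMConfig.raw, marked_sub_root, h3, h4, h2, Frame.sub]
    | appR u =>
      obtain ⟨rfl, h2⟩ := Term.app.inj hv'
      obtain ⟨ν, r, D, rfl, rfl, hr, hm⟩ := L.exists_position τ h2
      have hat : ∀ D', D = D' → IsAt (⟨d, r.sub (L.nodeSub ν), Ctx.sub (L.nodeSub ν) D ++
          L.hatCtx ν ++ [.appR L.out], T, hv⟩ : IAMConfig (L.program τ)) ν r D' := by
        rintro _ rfl; exact ⟨⟨_, rfl⟩, hr, hm⟩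
      cases hp : ν.parent with
      | none =>
        have hctx := L.hatCtx_of_parent hp
        by_cases hD : D = []
        · subst hD
          cases d with
          | down =>
            refine ⟨_, _, _, ?_, (hat _ rfl).sim_down_root rfl hp,
              .inr ⟨.stay, _, hp, rfl, rfl, rfl, ?_⟩⟩
            · exact hH
            · have hr : r = L.marked ν.label := hr
              simp [RawConfig.lift, IAMConfig.raw, hctx, Frame.sub, out_sub, hr]
          | up =>
            refine ⟨_, _, _, ?_, (hat _ rfl).sim_up_root rfl hp,
              .inr ⟨.stay, _, hp, rfl, rfl, rfl, ?_⟩⟩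
            · exact hH
            · have hr : r = L.marked ν.label := hr
              simp [RawConfig.lift, IAMConfig.raw, hctx, Frame.sub, out_sub, hr]
        · refine ⟨_, _, _, ?_, (hat _ rfl).sim_inner hD,
            .inr ⟨.stay, _, hp, rfl, rfl, ?_, ?_⟩⟩
          · exact ⟨⟨_, hr⟩, hD, hm, hH⟩
          · rw [RawConfig.term, Ctx.plug_append, hr]
            rfl
          · simp [RawConfig.lift, IAMConfig.raw, hctx, Frame.sub, out_sub]
      | some x =>
        obtain ⟨ξ, j⟩ := x
        by_cases hD : D = []
        · subst hD
          cases d with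
          | down =>
            refine ⟨_, _, _, ?_, (hat _ rfl).sim_down rfl hp, .inl ⟨ξ, j, _, hp, rfl, rfl, ?_⟩⟩
            · exact hH
            · have hr : r = L.marked ν.label := hr
              simp [RawConfig.lift, IAMConfig.raw, hr]
          | up =>
            refine ⟨_, _, _, ?_, (hat _ rfl).sim_up rfl hp, ?_⟩
            · exact hH
            · have hr : r = L.marked ν.label := hr
              -- An upward token at the top of a child's copy is read in the parent's copy as
              -- leaving `◊ⱼ`. The parent may itself be the root, which has its own transition map.
              obtain rfl := Node.eq_childAt_of_parent hp
              cases hξ : ξ.parent with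
              | none =>
                refine .inr ⟨.child j, _, hξ, rfl, rfl, ?_, ?_⟩
                · rw [RawConfig.term, Ctx.plug_append, plug_markCtx]
                  rfl
                · simp [RawConfig.lift, IAMConfig.raw, hatCtx_childAt, L.hatCtx_of_parent hξ,
                    Frame.sub, out_sub, hr, Term.sub, nodeSub_childAt]
              | some y =>
                refine .inl ⟨y.1, y.2, _, hξ, rfl, L.plug_markCtx _ _, ?_⟩
                simp [RawConfig.lift, IAMConfig.raw, hatCtx_childAt, hr, Term.sub,
                  nodeSub_childAt]
        · refine ⟨_, _, _, ?_, (hat _ rfl).sim_inner hD, .inl ⟨ξ, j, _, hp, rfl, hr, ?_⟩⟩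
          · exact ⟨⟨_, hr⟩, hD, hm, hH⟩
          · simp [RawConfig.lift, IAMConfig.raw]

/-- The hypotheses exclude the two configurations that no move encodes: down on the whole term and
up on a formal constant. By `rawStep_target`, no step leads to them. -/
theorem exists_exit {H : ℕ} (a : Γ.Letter) (c : RawConfig S) (hH : c.tape.length ≤ H)
    (hc : c.term = L.marked a) (hdown : c.dir = .down → c.ctx ≠ [])
    (hup : c.dir = .up → ∀ i, c.focus ≠ .mark i) :
    ∃ y : L.Q H × Dir (Γ.rk a), L.exit a (y.1.1, y.2) = some c := by
  obtain ⟨d, t, C, T⟩ := c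
  by_cases hC : C = []
  · subst hC
    obtain rfl : t = L.marked a := hc
    cases d with
    | down => exact absurd rfl (hdown rfl)
    | up => exact ⟨(⟨.delta T, hH⟩, .parent), rfl⟩
  · by_cases ht : ∃ i, t = .mark i
    · obtain ⟨i, rfl⟩ := ht
      obtain ⟨hi, rfl⟩ := L.eq_markCtx hc
      cases d with
      | down => exact ⟨(⟨.nabla T, hH⟩, .child ⟨i, hi⟩), rfl⟩
      | up => exact absurd rfl (hup rfl i)
    · exact ⟨(⟨.T d t C T, ⟨a, hc⟩, hC, not_exists.1 ht, hH⟩, .stay), rfl⟩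

theorem exists_rootExit {H : ℕ} (a : Γ.Letter) (c : RawConfig S) (hH : c.tape.length ≤ H)
    (hc : c.term = .app L.out (L.marked a)) (hctx : c.ctx ≠ [])
    (hup : c.dir = .up → ∀ i, c.focus ≠ .mark i) :
    ∃ y : L.Q H × RootDir (Γ.rk a), L.rootExit a (y.1.1, y.2) = some c := by
  obtain ⟨d, t, C, T⟩ := c
  rcases C.eq_nil_or_concat with rfl | ⟨C', f, rfl⟩
  · exact absurd rfl hctx
  · rw [List.concat_eq_append] at hc ⊢
    rw [RawConfig.term, Ctx.plug_append] at hc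
    cases f with
    | lam | bang | letArg _ | letBody _ => cases hc
    | appL u =>
      obtain ⟨h1, rfl⟩ := Term.app.inj hc
      exact ⟨(⟨.U d t C' T, h1, hH⟩, .stay), rfl⟩
    | appR u =>
      obtain ⟨rfl, h1⟩ := Term.app.inj hc
      by_cases hC : C' = []
      · subst hC
        obtain rfl : t = L.marked a := h1
        cases d with
        | down => exact ⟨(⟨.nabla T, hH⟩, .stay), rfl⟩
        | up => exact ⟨(⟨.delta T, hH⟩, .stay), rfl⟩
      · by_cases ht : ∃ i, t = .mark i
        · obtain ⟨i, rfl⟩ := ht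
          obtain ⟨hi, rfl⟩ := L.eq_markCtx h1
          cases d with
          | down => exact ⟨(⟨.nabla T, hH⟩, .child ⟨i, hi⟩), rfl⟩
          | up => exact absurd rfl (hup rfl i)
        · exact ⟨(⟨.T d t C' T, ⟨a, h1⟩, hC, not_exists.1 ht, hH⟩, .stay), rfl⟩

/-- These are the side conditions of `rawStep_lift`: a decoded source is never about to cross a
boundary, since the crossing is part of the preceding move. -/
theorem entry_not_exit {H : ℕ} {a : Γ.Letter} {q : State S} {p : Dir (Γ.rk a)}
    {c : RawConfig S} (hq : L.IsState H q) (h : L.entry a (q, p) = some c) :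
    (c.dir = .down → ∀ i, c.focus ≠ .mark i) ∧ (c.dir = .up → c.ctx ≠ []) := by
  cases q <;> cases p <;> cases h
  · exact ⟨fun _ => hq.2.2.1, fun _ => hq.2.1⟩
  · exact ⟨fun _ => L.marked_ne_mark a, nofun⟩
  · exact ⟨nofun, fun _ => by simp [markCtx, Term.argCtx]⟩

theorem rootEntry_not_exit {H : ℕ} {a : Γ.Letter} {q : State S} {p : RootDir (Γ.rk a)}
    {c : RawConfig S} (hq : L.IsState H q) (h : L.rootEntry a (q, p) = some c) :
    c.dir = .down → ∀ i, c.focus ≠ .mark i := by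
  cases q <;> cases p <;> cases h
  · simp
  · exact fun _ => hq.2.2.1
  · rintro - i rfl
    -- `U` states carry no condition on formal constants, as none occurs in `u`.
    exact L.plug_mark_ne_out _ _ hq.1
  · exact fun _ => L.marked_ne_mark a
  · exact nofun
  · exact nofun

open Classical in
/-- The translation of configurations, with states in `Q_H`. -/
noncomputable def simQ (H : ℕ) (τ : GroundTree Γ) (κ : IAMConfig (L.program τ)) :
    TWTConfig (L.Q H) τ :=
  if h : L.IsState H (L.sim τ κ).state then ⟨⟨_, h⟩, (L.sim τ κ).node, (L.sim τ κ).prov⟩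
  -- A default value, never taken on reachable configurations.
  else ⟨L.initState H, .root, .stay⟩

theorem simQ_eq {H : ℕ} {τ : GroundTree Γ} {κ : IAMConfig (L.program τ)}
    {x : TWTConfig (L.Q H) τ} (h : L.sim τ κ = x.mapState Subtype.val) : L.simQ H τ κ = x := by
  have h1 : L.IsState H (L.sim τ κ).state := by rw [h]; exact x.state.2
  rw [simQ, dif_pos h1]
  obtain ⟨⟨q, hq⟩, ν, p⟩ := x
  generalize L.sim τ κ = y at h h1
  subst h
  rfl

end LambdaTransducer

/-! ### Steps of a tree-walking transducer at the root and elsewhere -/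

theorem TWT.mapState_move {Q Q' : Type} (f : Q → Q') {τ : GroundTree Γ} (ν ξ : Node τ)
    (j : Fin ξ.arity) (x : Q × Dir ν.arity) :
    (TWT.move ν ξ j x).mapState f = TWT.move ν ξ j (f x.1, x.2) := by
  obtain ⟨q, p⟩ := x
  cases p <;> rfl

theorem TWT.mapState_moveRoot {Q Q' : Type} (f : Q → Q') {τ : GroundTree Γ} (ν : Node τ)
    (x : Q × RootDir ν.arity) :
    (TWT.moveRoot ν x).mapState f = TWT.moveRoot ν (f x.1, x.2) := by
  obtain ⟨q, p⟩ := x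
  cases p <;> rfl

theorem TWT.step_of_parent {Q : Type} (M : TWT Γ S Q) {τ : GroundTree Γ} {q : Q} {ν ξ : Node τ}
    {j : Fin ξ.arity} {p : Dir ν.arity} (h : ν.parent = some ⟨ξ, j⟩) :
    M.step τ ⟨q, ν, p⟩ = (M.δ ν.label (q, p)).map (Tree.map (TWT.move ν ξ j)) := by
  simp only [TWT.step, h]

theorem TWT.step_of_root {Q : Type} (M : TWT Γ S Q) {τ : GroundTree Γ} {q : Q} {ν : Node τ}
    {p : RootDir ν.arity} (h : ν.parent = none) :
    M.step τ ⟨q, ν, p.toDir⟩ = (M.δroot ν.label (q, p)).map (Tree.map (TWT.moveRoot ν)) := by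
  cases p <;> simp only [TWT.step, h, RootDir.toDir]

/-! ### The simulation -/

namespace LambdaTransducer
variable (L : LambdaTransducer Γ S)

theorem toTWT_simulation {H : ℕ} (hH : L.TapeBound H) (hA : L.memory.AlmostPurelyAffine)
    (hu : L.out.Normal) (ht : ∀ a, (L.trans a).Normal) (τ : GroundTree Γ) :
    (∀ κ, (apaiam (L.program τ)).Reachable κ →
      (L.simQ H τ κ).mapState Subtype.val = L.sim τ κ) ∧
    (apaiam (L.program τ)).IsSimulation ((L.toTWT H).machine τ) (L.simQ H τ) := by
  obtain ⟨N, hL⟩ := L.exists_fragment_affineBelow hA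
  have hnil : ∀ κ : IAMConfig (L.program τ), (apaiam (L.program τ)).Reachable κ →
      κ.ctx = [] → κ.dir = .down ∧ κ.tape = [] := fun κ hκ =>
    (typed_of_reachable hL.closed (fun A h => h.eq_o)
      (hL.app_out_typed hu (hL.hat_typed ht τ)) hκ).of_ctx_nil
  have hsim : ∀ κ : IAMConfig (L.program τ), (apaiam (L.program τ)).Reachable κ →
      ∃ q ν p, L.simQ H τ κ = ⟨q, ν, p⟩ ∧ L.sim τ κ = ⟨q.1, ν, p⟩ ∧
        L.Describes q.1 ν p κ.raw := by
    intro κ hκ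
    obtain ⟨q, ν, p, hq, h1, h2⟩ := L.exists_describes κ (hH τ κ hκ) (hnil κ hκ)
    exact ⟨⟨q, hq⟩, ν, p, L.simQ_eq h1, h1, h2⟩
  refine ⟨fun κ hκ => ?_, L.simQ_eq (sim_of_nil rfl), fun κ hκ => ?_⟩
  · obtain ⟨q, ν, p, h1, h2, -⟩ := hsim κ hκ
    rw [h1, h2]
    rfl
  obtain ⟨q, ν, p, h1, -, h2⟩ := hsim κ hκ
  change (L.toTWT H).step τ (L.simQ H τ κ) = (iamStep (L.program τ) κ).map _
  rw [h1]
  have hσ := L.nodeSub_closed hL ht ν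
  have hm := (hL.marked_typed ht ν.label).closed
  rcases h2 with ⟨ξ, j, c, hp, hx, hc, hκc⟩ | ⟨p', c, hp, rfl, hx, hc, hκc⟩
  · rw [TWT.step_of_parent _ hp]
    obtain ⟨h3, h4⟩ := L.entry_not_exit q.2 hx
    refine localStep_simulation hσ _ hm (entry := fun x : L.Q H × Dir ν.arity => L.entry ν.label (x.1.1, x.2)) hx hc hκc
      h3 (fun hd hC => absurd hC (h4 hd)) _ _ ?_ ?_
    · intro κ' c' hκ' hκc' hc' h5 h6
      refine L.exists_exit _ _ ?_ hc' h5 h6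
      have := hH τ κ' (hκ.tail hκ')
      rwa [show κ'.tape = c'.tape from congrArg RawConfig.tape hκc'] at this
    · intro κ' c' y hy hκc' hc'
      refine L.simQ_eq ?_
      rw [TWT.mapState_move]
      exact L.sim_eq_move hp y.1.2 hy hκc' hc'
  · rw [TWT.step_of_root _ hp]
    -- At the root the local term is all of `u τ̂` after substitution: the outer context is empty,
    -- and the condition on upward exits is trivial.
    refine localStep_simulation hσ _ (hL.app_out_typed hu (hL.marked_typed ht ν.label)).closed
      (entry := fun x : L.Q H × RootDir ν.arity => L.rootEntry ν.label (x.1.1, x.2)) hx hc hκc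
      (L.rootEntry_not_exit q.2 hx) (fun _ _ => rfl) _ _ ?_ ?_
    · intro κ' c' hκ' hκc' hc' h5 h6
      have hr := hκ.tail hκ'
      refine L.exists_rootExit _ _ ?_ hc' ?_ h6
      · have := hH τ κ' hr
        rwa [show κ'.tape = c'.tape from congrArg RawConfig.tape hκc'] at this
      -- A reachable configuration focused on the whole term goes down, but a step never ends going
      -- down with an empty context.
      · intro h7
        have h8 : κ'.ctx = [] := by
          have : κ'.ctx = _ := congrArg RawConfig.ctx hκc'
          simpa [RawConfig.lift, h7] using this
        refine h5 ?_ h7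
        rw [← (hnil κ' hr h8).1]
        exact (congrArg RawConfig.dir hκc').symm
    · intro κ' c' y hy hκc' hc'
      refine L.simQ_eq ?_
      rw [TWT.mapState_moveRoot]
      exact L.sim_eq_moveRoot hp y.1.2 hy hκc' hc'

end LambdaTransducer
end LamTWT

theorem lemma5p2 {Γ S : LamTWT.RankedAlphabet} (L : LamTWT.LambdaTransducer Γ S)
    (hA : L.memory.AlmostPurelyAffine)
    (hu : L.out.Normal) (ht : ∀ a, (L.trans a).Normal) :
    (∃ H, L.TapeBound H) ∧
    ∀ H, L.TapeBound H →
      ∃ M : LamTWT.TWT Γ S (L.Q H),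
        M.init = L.initState H ∧
        (∀ τ : LamTWT.GroundTree Γ,
          ∃ f : LamTWT.IAMConfig (L.program τ) → LamTWT.TWTConfig (L.Q H) τ,
            (∀ κ, (LamTWT.apaiam (L.program τ)).Reachable κ →
              (f κ).mapState Subtype.val = L.sim τ κ) ∧
            (LamTWT.apaiam (L.program τ)).IsSimulation (M.machine τ) f) ∧
        (L.memory.PurelyAffine → M.Reversible) :=
  ⟨L.exists_tapeBound hA hu ht, fun H hH => ⟨L.toTWT H, rfl,
    fun τ => ⟨L.simQ H τ, L.toTWT_simulation hH hA hu ht τ⟩,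
    fun hP => L.toTWT_reversible H hP hu ht⟩⟩
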